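/- A \emph{hyperbolic space} is a nonempty geodesic metric space $X$ that is Gromov hyperbolic, i.e. there is $\delta$ with $(x\mid z)_o\ge \min\{(x\mid y)_o,(y\mid z)_o\}-\delta$ for all $o,x,y,z\in X$, where $(x\mid y)_o=\tfrac12\big(d(o,x)+d(o,y)-d(x,y)\big)$; it need not be proper. Its Gromov boundary $\partial X$ is the set of equivalence classes of sequences converging at infinity. All actions are by isometries. For a group $G$ acting on $X$, the limit set $\Lambda(G)\subseteq\partial X$ is the set of limits in $\partial X$ of sequences in an orbit of $G$. The action is \emph{elementary} if $|\Lambda(G)|\le 2$ and \emph{non-elementary} otherwise; it is of \emph{general type} if it is non-elementary and $G$ fixes no point of $\partial X$. An element $g\in G$ is \emph{loxodromic} if $n\mapsto g^n x$, $n\in\mathbb Z$, is a quasi-isometric embedding for some (equivalently, every) $x\in X$. A group $G$ has property (NGT) if no action of $G$ on a hyperbolic space is of general type, property (NNE) if no action of $G$ on a hyperbolic space is non-elementary, and property (NL) if no action of $G$ on a hyperbolic space has a loxodromic element. A group is \emph{hereditary} (NGT) (respectively (NNE), (NL)) if all of its finite-index subgroups have (NGT) (respectively (NNE), (NL)). Two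 groups are \emph{commensurable} if they contain isomorphic finite-index subgroups. \textbf{Proposition.} (1) Let $P$ be one of the six properties (NGT), (NNE), (NL), hereditary (NGT), hereditary (NNE), hereditary (NL). Then: (i) every quotient of a group with $P$ has $P$; (ii) if a group is the union of a nonempty directed family of subgroups each of which has $P$, then it has $P$; (iii) the direct sum of any family of groups with $P$ (the group of finitely supported elements of their product) has $P$. (2) If $G$ and $H$ are commensurable groups and $G$ is hereditary (NL) (respectively hereditary (NNE), hereditary (NGT)), then so is $H$. (3) Property (NL) itself is not invariant under commensurability: there are commensurable groups $G$ and $H$ such that $G$ has (NL) and $H$ does not. -/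

import Mathlib

universe u w

namespace HypAct

open Filter Set

/-- The Gromov product `(x | y)_o`. -/
noncomputable def gromovProduct {X : Type w} [MetricSpace X] (o x y : X) : ℝ :=
  (dist o x + dist o y - dist x y) / 2

/-- A hyperbolic space: a nonempty geodesic metric space satisfying Gromov's four-point
condition for some constant `δ`. Neither properness nor completeness is required. -/
class HyperbolicSpace (X : Type w) [MetricSpace X] : Prop where
  nonempty : Nonempty X
  geodesic : ∀ x y : X, ∃ γ : ℝ → X, γ 0 = x ∧ γ (dist x y) = y ∧
    ∀ s ∈ Icc 0 (dist x y), ∀ t ∈ Icc 0 (dist x y), dist (γ s) (γ t) = |s - t|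
  four_point : ∃ δ : ℝ, ∀ o x y z : X,
    min (gromovProduct o x y) (gromovProduct o y z) - δ ≤ gromovProduct o x z

section Boundary

variable {X : Type w} [MetricSpace X]

/-- `(x m | y n)_o → ∞` as `m, n → ∞` (for every basepoint, equivalently for one). -/
def Asymptotic (x y : ℕ → X) : Prop :=
  ∀ o : X, Tendsto (fun p : ℕ × ℕ => gromovProduct o (x p.1) (y p.2)) atTop atTop

/-- A sequence converges at infinity if `(x m | x n)_o → ∞` as `m, n → ∞`. -/
def ConvergesAtInfinity (x : ℕ → X) : Prop := Asymptotic x x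

theorem gromovProduct_comm (o x y : X) : gromovProduct o x y = gromovProduct o y x := by
  unfold gromovProduct; rw [dist_comm x y]; ring

theorem Asymptotic.symm {x y : ℕ → X} (h : Asymptotic x y) : Asymptotic y x := by
  intro o
  have hs : Tendsto (Prod.swap : ℕ × ℕ → ℕ × ℕ) atTop atTop := by
    rw [← prod_atTop_atTop_eq]; exact tendsto_prod_swap
  refine ((h o).comp hs).congr fun p => ?_
  exact gromovProduct_comm _ _ _

theorem Asymptotic.trans [HyperbolicSpace X] {x y z : ℕ → X}
    (hxy : Asymptotic x y) (hyz : Asymptotic y z) : Asymptotic x z := by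
  intro o
  obtain ⟨δ, hδ⟩ := HyperbolicSpace.four_point (X := X)
  rw [tendsto_atTop]
  intro b
  obtain ⟨⟨a₁, a₂⟩, ha⟩ := eventually_atTop.1 (tendsto_atTop.1 (hxy o) (b + δ))
  obtain ⟨⟨c₁, c₂⟩, hc⟩ := eventually_atTop.1 (tendsto_atTop.1 (hyz o) (b + δ))
  refine eventually_atTop.2 ⟨(a₁, c₂), ?_⟩
  rintro ⟨m, n⟩ hmn
  have h1 := ha (m, max a₂ c₁) ⟨hmn.1, le_max_left _ _⟩
  have h2 := hc (max a₂ c₁, n) ⟨le_max_right _ _, hmn.2⟩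
  have h3 := hδ o (x m) (y (max a₂ c₁)) (z n)
  have h4 := le_min h1 h2
  dsimp only at h4 ⊢
  linarith

variable (X) in
/-- Sequences converging at infinity, up to being asymptotic. -/
def boundarySetoid [HyperbolicSpace X] : Setoid {x : ℕ → X // ConvergesAtInfinity x} where
  r x y := Asymptotic x.1 y.1
  iseqv := ⟨fun x => x.2, fun h => h.symm, fun h h' => h.trans h'⟩

variable (X) in
/-- The Gromov boundary `∂X`. -/
def Boundary [HyperbolicSpace X] : Type w := Quotient (boundarySetoid X)

variable {G : Type u} [Group G] [MulAction G X] [IsIsometricSMul G X]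

theorem Asymptotic.smul {x y : ℕ → X} (h : Asymptotic x y) (g : G) :
    Asymptotic (fun n => g • x n) (fun n => g • y n) := by
  intro o
  refine (h (g⁻¹ • o)).congr fun p => ?_
  have key : ∀ a : X, dist (g⁻¹ • o) a = dist o (g • a) := fun a => by
    rw [← dist_smul g (g⁻¹ • o) a, smul_inv_smul]
  simp only [gromovProduct, key, dist_smul]

/-- The action on the boundary induced by an isometric action. -/
instance boundaryAction [HyperbolicSpace X] : MulAction G (Boundary X) where
  smul g := Quotient.map (sa := boundarySetoid X) (sb := boundarySetoid X)
    (fun x => ⟨fun n => g • x.1 n, Asymptotic.smul x.2 g⟩)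
    (fun _ _ h => Asymptotic.smul h g)
  one_smul ξ := by
    induction ξ using Quotient.inductionOn with
    | h x => exact congrArg (Quotient.mk _) (Subtype.ext (funext fun n => one_smul G (x.1 n)))
  mul_smul g h ξ := by
    induction ξ using Quotient.inductionOn with
    | h x => exact congrArg (Quotient.mk _) (Subtype.ext (funext fun n => mul_smul g h (x.1 n)))

end Boundary

section Actions

variable (G : Type u) [Group G] (X : Type w) [MetricSpace X] [MulAction G X]

variable {G} in
/-- `g` is loxodromic if `n ↦ gⁿ x` is a quasi-isometric embedding `ℤ → X` for some `x`
(equivalently for every `x`). -/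
def IsLoxodromic (g : G) : Prop :=
  ∃ x : X, ∃ L C : ℝ, 1 ≤ L ∧ 0 ≤ C ∧ ∀ m n : ℤ,
    |(m : ℝ) - n| / L - C ≤ dist (g ^ m • x) (g ^ n • x) ∧
    dist (g ^ m • x) (g ^ n • x) ≤ L * |(m : ℝ) - n| + C

variable [HyperbolicSpace X]

/-- The limit set `Λ(G)`: the points of `∂X` that are limits of sequences in an orbit `G x`
(the set does not depend on the orbit). A sequence of points of `X` converges to `ξ ∈ ∂X`
exactly if it converges at infinity and represents `ξ`. -/
def limitSet : Set (Boundary X) :=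
  {ξ | ∃ (x : X) (g : ℕ → G) (h : ConvergesAtInfinity (fun n => g n • x)),
    ξ = Quotient.mk (boundarySetoid X) ⟨fun n => g n • x, h⟩}

/-- The action is elementary if `|Λ(G)| ≤ 2`. -/
def IsElementary : Prop := (limitSet G X).encard ≤ 2

/-- The action is of general type if it is non-elementary and fixes no point of `∂X`. -/
def IsGeneralType [IsIsometricSMul G X] : Prop :=
  ¬ IsElementary G X ∧ ¬ ∃ ξ : Boundary X, ∀ g : G, g • ξ = ξ

end Actions

/-- A property of groups. -/
abbrev GroupProperty : Type (u + 1) := ∀ (G : Type u) [Group G], Prop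

/-- No isometric action of `G` on a hyperbolic space (in an arbitrary universe `w`) is of
general type. -/
def NGT : GroupProperty.{u} := fun G _ =>
  ∀ (X : Type w) [MetricSpace X] [HyperbolicSpace X] [MulAction G X] [IsIsometricSMul G X],
    ¬ IsGeneralType G X

/-- Every isometric action of `G` on a hyperbolic space is elementary. -/
def NNE : GroupProperty.{u} := fun G _ =>
  ∀ (X : Type w) [MetricSpace X] [HyperbolicSpace X] [MulAction G X] [IsIsometricSMul G X],
    IsElementary G X

/-- No isometric action of `G` on a hyperbolic space has a loxodromic element. -/
def NL : GroupProperty.{u} := fun G _ =>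
  ∀ (X : Type w) [MetricSpace X] [HyperbolicSpace X] [MulAction G X] [IsIsometricSMul G X],
    ∀ g : G, ¬ IsLoxodromic X g

/-- All finite-index subgroups of `G` (including `G` itself) satisfy `P`. -/
def Hereditary (P : GroupProperty.{u}) : GroupProperty.{u} := fun G _ =>
  ∀ H : Subgroup G, H.FiniteIndex → P H

/-- The direct sum of a family of groups: the finitely supported elements of the product. -/
def directSum {ι : Type u} (A : ι → Type u) [∀ i, Group (A i)] : Subgroup (∀ i, A i) where
  carrier := {f | {i | f i ≠ 1}.Finite}
  one_mem' := by simp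
  mul_mem' {f g} hf hg := by
    refine (Set.Finite.union hf hg).subset fun i hi => ?_
    by_contra hcon
    simp only [mem_union, mem_ofPred_eq, not_or, not_not] at hcon
    exact hi (by simp [hcon.1, hcon.2])
  inv_mem' {f} hf := by simpa using hf

/-- Two groups are commensurable if they contain isomorphic finite-index subgroups. -/
def CommensurableGroups (G H : Type u) [Group G] [Group H] : Prop :=
  ∃ (G₀ : Subgroup G) (H₀ : Subgroup H),
    G₀.FiniteIndex ∧ H₀.FiniteIndex ∧ Nonempty (G₀ ≃* H₀)

/-- `P` passes to quotients, i.e. to homomorphic images. -/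
def PreservedByQuotients (P : GroupProperty.{u}) : Prop :=
  ∀ (G Q : Type u) [Group G] [Group Q] (f : G →* Q), Function.Surjective f → P G → P Q

/-- If `G` is the union of a directed family of subgroups satisfying `P`, then `G` satisfies
`P`. -/
def PreservedByDirectedUnions (P : GroupProperty.{u}) : Prop :=
  ∀ (G : Type u) [Group G] (F : Set (Subgroup G)), F.Nonempty → DirectedOn (· ≤ ·) F →
    (∀ g : G, ∃ H ∈ F, g ∈ H) → (∀ H ∈ F, P H) → P G

/-- Direct sums of arbitrary families of groups satisfying `P` satisfy `P`. -/
def PreservedByDirectSums (P : GroupProperty.{u}) : Prop :=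
  ∀ (ι : Type u) (A : ι → Type u) [∀ i, Group (A i)], (∀ i, P (A i)) → P (directSum A)

/-- `P` passes from a group to every group commensurable to it. -/
def CommensurabilityInvariant (P : GroupProperty.{u}) : Prop :=
  ∀ (G H : Type u) [Group G] [Group H], CommensurableGroups G H → P G → P H

/-- `P` is preserved by quotients, directed unions and direct sums. -/
def Stable (P : GroupProperty.{u}) : Prop :=
  PreservedByQuotients P ∧ PreservedByDirectedUnions P ∧ PreservedByDirectSums P

end HypAct

namespace HypAct

open Filter Set

/-! ### Gromov products and convergence to boundary points. -/

section Geometry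

variable {X : Type w} [MetricSpace X]

/-! Loxodromic elements carry the whole proof. Such an element has two distinct poles on the
boundary (`IsLoxodromic.exists_hasPoles`), and two limit points force a loxodromic element
(`exists_isLoxodromic`), so a non-elementary action has one. Conversely, a group preserving a pair
of boundary points has no limit point outside it (`eq_or_eq_of_convergesTo`). Hence an action is
non-elementary exactly when some loxodromic element has a pole pair that another element does not
preserve. General type needs two further elements, one moving each pole. Finite witnesses pass to
directed unions.

If a normal subgroup contains a loxodromic element, a non-elementary or general type action of the
group stays so on the subgroup. This applies to a product, because a loxodromic product of commuting
elements has a loxodromic factor (`IsLoxodromic.of_commute`), and to finite extensions, because a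
power of a loxodromic element lies in the normal core. Direct sums are directed unions of finite
products.

The hereditary statements and their commensurability invariance follow formally by intersecting
finite-index subgroups.

For (NL) itself, compare ℤ² with its extension by the rotation of order four. A translation commutes
with its rotated copy, so the rotation would preserve its pole pair and the square of the rotation
would fix both poles; but that square inverts the translation and must swap them. -/

theorem gromovProduct_nonneg (o x y : X) : 0 ≤ gromovProduct o x y := by
  unfold gromovProduct
  have := dist_triangle x o y
  rw [dist_comm x o] at this
  linarith

theorem gromovProduct_self (o x : X) : gromovProduct o x x = dist o x := by
  simp [gromovProduct]

theorem gromovProduct_le_add_dist (o o' x y : X) :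
    gromovProduct o x y ≤ gromovProduct o' x y + dist o o' := by
  unfold gromovProduct
  have h1 := dist_triangle o o' x
  have h2 := dist_triangle o o' y
  linarith

theorem gromovProduct_le_add_dist_right (o x y z : X) :
    gromovProduct o x y ≤ gromovProduct o x z + dist y z := by
  unfold gromovProduct
  have h1 := dist_triangle o z y
  have h2 := dist_triangle x y z
  rw [dist_comm z y] at h1
  linarith

theorem gromovProduct_change_base (o p x y : X) :
    gromovProduct p x y =
      gromovProduct o x y + dist o p - gromovProduct o x p - gromovProduct o y p := by
  unfold gromovProduct
  rw [dist_comm p x, dist_comm p y]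
  ring

theorem Asymptotic.of_basepoint {x y : ℕ → X} (o : X)
    (h : Tendsto (fun p : ℕ × ℕ => gromovProduct o (x p.1) (y p.2)) atTop atTop) :
    Asymptotic x y := by
  intro o'
  refine tendsto_atTop_mono (fun p => ?_) (tendsto_atTop_add_const_right _ (-dist o o') h)
  have := gromovProduct_le_add_dist o o' (x p.1) (y p.2)
  linarith

theorem Asymptotic.exists_forall_le {x y : ℕ → X} (h : Asymptotic x y) (o : X) (b : ℝ) :
    ∃ N : ℕ, ∀ m ≥ N, ∀ n ≥ N, b ≤ gromovProduct o (x m) (y n) := by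
  obtain ⟨⟨a₁, a₂⟩, ha⟩ := eventually_atTop.1 (tendsto_atTop.1 (h o) b)
  exact ⟨max a₁ a₂, fun m hm n hn =>
    ha (m, n) ⟨(le_max_left _ _).trans hm, (le_max_right _ _).trans hn⟩⟩

theorem Asymptotic.of_exists_forall_le {x y : ℕ → X} (o : X)
    (h : ∀ b : ℝ, ∃ N : ℕ, ∀ m ≥ N, ∀ n ≥ N, b ≤ gromovProduct o (x m) (y n)) :
    Asymptotic x y := by
  refine Asymptotic.of_basepoint o (tendsto_atTop.2 fun b => ?_)
  obtain ⟨N, hN⟩ := h b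
  exact eventually_atTop.2 ⟨(N, N), fun p hp => hN _ hp.1 _ hp.2⟩

theorem Asymptotic.congr_right {x y z : ℕ → X} (h : Asymptotic x y) {C : ℝ}
    (hC : ∀ n, dist (y n) (z n) ≤ C) : Asymptotic x z := by
  intro o
  refine tendsto_atTop_mono (fun p => ?_) (tendsto_atTop_add_const_right _ (-C) (h o))
  have := gromovProduct_le_add_dist_right o (x p.1) (y p.2) (z p.2)
  have := hC p.2
  linarith

variable [HyperbolicSpace X]

variable (X) in
theorem exists_hyperbolicity_constant : ∃ δ : ℝ, 0 ≤ δ ∧ ∀ o x y z : X,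
    min (gromovProduct o x y) (gromovProduct o y z) - δ ≤ gromovProduct o x z := by
  obtain ⟨δ, hδ⟩ := HyperbolicSpace.four_point (X := X)
  refine ⟨max δ 0, le_max_right _ _, fun o x y z => ?_⟩
  have := hδ o x y z
  have := le_max_left δ 0
  linarith

/-- The bound depends only on the asymptotic classes, not on the representatives `x'`, `y'`. This
uniformity lets infinitely many translates be treated with one constant. -/
theorem exists_gromovProduct_le_of_not_asymptotic {x y : ℕ → X} (h : ¬ Asymptotic x y) (o : X) :
    ∃ C : ℝ, ∀ x' y' : ℕ → X, Asymptotic x x' → Asymptotic y y' →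
      ∃ N : ℕ, ∀ m ≥ N, ∀ n ≥ N, gromovProduct o (x' m) (y' n) ≤ C := by
  obtain ⟨δ, hδ, hyp⟩ := exists_hyperbolicity_constant X
  have h1 : ¬ ∀ b : ℝ, ∃ N : ℕ, ∀ m ≥ N, ∀ n ≥ N, b ≤ gromovProduct o (x m) (y n) :=
    fun h' => h (Asymptotic.of_exists_forall_le o h')
  push Not at h1
  obtain ⟨b, hb⟩ := h1
  -- Returning from `x'`, `y'` to `x`, `y` uses the four-point condition twice, each time losing
  -- `δ`.
  refine ⟨b + 2 * δ, fun x' y' hx hy => ?_⟩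
  obtain ⟨N₁, h1⟩ := hx.exists_forall_le o (b + 2 * δ)
  obtain ⟨N₂, h2⟩ := hy.exists_forall_le o (b + 2 * δ)
  obtain ⟨m, hm, n, hn, hmn⟩ := hb (max N₁ N₂)
  refine ⟨max N₁ N₂, fun m' hm' n' hn' => ?_⟩
  have e1 := h1 m (le_of_max_le_left hm) m' (le_of_max_le_left hm')
  have e2 := h2 n (le_of_max_le_right hn) n' (le_of_max_le_right hn')
  rw [gromovProduct_comm] at e2
  by_contra! hlt
  have e3 := hyp o (x m) (x' m') (y' n')
  have e4 := hyp o (x m) (y' n') (y n)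
  have e5 : b + 2 * δ ≤ min (gromovProduct o (x m) (x' m')) (gromovProduct o (x' m') (y' n')) :=
    le_min e1 hlt.le
  have e6 : b + δ ≤ min (gromovProduct o (x m) (y' n')) (gromovProduct o (y' n') (y n)) :=
    le_min (by linarith) (by linarith)
  linarith

/-- The sequence `x` converges to the boundary point `ξ`. -/
def ConvergesTo (x : ℕ → X) (ξ : Boundary X) : Prop :=
  ∃ h : ConvergesAtInfinity x, ξ = Quotient.mk (boundarySetoid X) ⟨x, h⟩

theorem exists_convergesTo (ξ : Boundary X) : ∃ x : ℕ → X, ConvergesTo x ξ := by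
  induction ξ using Quotient.inductionOn with
  | h x => exact ⟨x.1, x.2, rfl⟩

theorem ConvergesTo.eq_iff {x y : ℕ → X} {ξ η : Boundary X} (hx : ConvergesTo x ξ)
    (hy : ConvergesTo y η) : ξ = η ↔ Asymptotic x y := by
  obtain ⟨h, rfl⟩ := hx
  obtain ⟨h', rfl⟩ := hy
  exact Quotient.eq (r := boundarySetoid X)

theorem ConvergesTo.of_asymptotic {x y : ℕ → X} {ξ : Boundary X} (hx : ConvergesTo x ξ)
    (h : Asymptotic x y) : ConvergesTo y ξ := by
  have hy : ConvergesAtInfinity y := h.symm.trans h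
  exact ⟨hy, (hx.eq_iff ⟨hy, rfl⟩).2 h⟩

theorem ConvergesTo.of_dist_le {x y : ℕ → X} {ξ : Boundary X} (hx : ConvergesTo x ξ) {C : ℝ}
    (h : ∀ n, dist (x n) (y n) ≤ C) : ConvergesTo y ξ :=
  hx.of_asymptotic (hx.1.congr_right h)

theorem ConvergesTo.unique {x : ℕ → X} {ξ η : Boundary X} (hx : ConvergesTo x ξ)
    (hy : ConvergesTo x η) : ξ = η :=
  (hx.eq_iff hy).2 hx.1

theorem ConvergesTo.exists_lt_dist {x : ℕ → X} {ξ : Boundary X} (hx : ConvergesTo x ξ) (o : X)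
    (b : ℝ) : ∃ N : ℕ, ∀ n ≥ N, b < dist o (x n) := by
  obtain ⟨N, hN⟩ := hx.1.exists_forall_le o (b + 1)
  refine ⟨N, fun n hn => ?_⟩
  have := hN n hn n hn
  rw [gromovProduct_self] at this
  linarith

theorem exists_gromovProduct_le_of_ne {x y : ℕ → X} {ξ η : Boundary X} (hx : ConvergesTo x ξ)
    (hy : ConvergesTo y η) (h : ξ ≠ η) (o : X) :
    ∃ C : ℝ, ∃ N : ℕ, ∀ m ≥ N, ∀ n ≥ N, gromovProduct o (x m) (y n) ≤ C := by
  obtain ⟨C, hC⟩ := exists_gromovProduct_le_of_not_asymptotic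
    (fun h' => h ((hx.eq_iff hy).2 h')) o
  exact ⟨C, hC x y hx.1 hy.1⟩

end Geometry

/-! ### Displacement of powers and loxodromic elements. -/

section Action

variable {X : Type w} [MetricSpace X] {G : Type u} [Group G] [MulAction G X]

theorem IsLoxodromic.exists_le_dist {g : G} (h : IsLoxodromic X g) :
    ∃ x : X, ∃ L C : ℝ, 1 ≤ L ∧ 0 ≤ C ∧ ∀ n : ℕ, n / L - C ≤ dist x (g ^ n • x) := by
  obtain ⟨x, L, C, hL, hC, h⟩ := h
  refine ⟨x, L, C, hL, hC, fun n => ?_⟩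
  have := (h 0 n).1
  simpa using this

theorem not_isLoxodromic_one : ¬ IsLoxodromic X (1 : G) := by
  intro h
  obtain ⟨x, L, C, hL, hC, h⟩ := h.exists_le_dist
  obtain ⟨n, hn⟩ := exists_nat_gt (C * L)
  have := h n
  rw [← lt_div_iff₀ (by linarith)] at hn
  simp only [one_pow, one_smul, dist_self] at this
  linarith

/-- Otherwise each doubling of the exponent would add less than `B`, so displacement at exponent `2
^ k` would be at most linear in `k`, against the lower bound of order `2 ^ k`. -/
theorem IsLoxodromic.exists_dist_add_le {g : G} (h : IsLoxodromic X g) (B : ℝ) :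
    ∃ N : ℕ, ∃ x : X, dist x (g ^ N • x) + B ≤ dist x ((g ^ N) ^ 2 • x) := by
  obtain ⟨x, L, C, hL, hC, h⟩ := h.exists_le_dist
  have hL0 : 0 < L := by linarith
  by_contra! hcon
  have key : ∀ k : ℕ, dist x (g ^ 2 ^ k • x) ≤ dist x (g • x) + k * B := by
    intro k
    induction k with
    | zero => simp
    | succ k ih =>
      have := hcon (2 ^ k) x
      rw [← pow_mul, ← pow_succ] at this
      push_cast
      linarith
  have lim : Tendsto (fun k : ℕ => ((k : ℝ) ^ 1 / 2 ^ k) * B + (C + dist x (g • x)) / 2 ^ k) atTop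
      (nhds (0 * B + 0)) :=
    ((tendsto_pow_const_div_const_pow_of_one_lt 1 one_lt_two).mul_const B).add
      (tendsto_const_nhds.div_atTop (tendsto_pow_atTop_atTop_of_one_lt one_lt_two))
  have hpos : (0 : ℝ) * B + 0 < 1 / L := by simp; positivity
  obtain ⟨k, hk⟩ := (lim.eventually (gt_mem_nhds hpos)).exists
  have h1 := h (2 ^ k)
  have h2 := key k
  push_cast at h1
  have h3 : (0 : ℝ) < 2 ^ k := by positivity
  have h4 : ((k : ℝ) ^ 1 / 2 ^ k) * B + (C + dist x (g • x)) / 2 ^ k =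
    (k * B + C + dist x (g • x)) / 2 ^ k := by field_simp; ring
  rw [h4, div_lt_div_iff₀ h3 hL0] at hk
  have h5 : (2 : ℝ) ^ k / L ≤ k * B + C + dist x (g • x) := by linarith
  rw [div_le_iff₀ hL0] at h5
  linarith

variable [IsIsometricSMul G X]

theorem dist_smul_eq_dist_inv_smul (g : G) (x y : X) : dist x (g • y) = dist (g⁻¹ • x) y := by
  rw [← dist_smul g (g⁻¹ • x) y, smul_inv_smul]

theorem gromovProduct_smul (g : G) (o x y : X) :
    gromovProduct (g • o) (g • x) (g • y) = gromovProduct o x y := by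
  simp only [gromovProduct, dist_smul]

theorem dist_pow_smul_le (g : G) (x : X) (n : ℕ) :
    dist x (g ^ n • x) ≤ n * dist x (g • x) := by
  induction n with
  | zero => simp
  | succ n ih =>
    have h1 := dist_triangle x (g ^ n • x) (g ^ (n + 1) • x)
    rw [pow_succ, mul_smul, dist_smul] at h1
    rw [pow_succ, mul_smul]
    push_cast
    linarith

theorem dist_zpow_smul_zpow_smul (g : G) (x : X) (m n : ℤ) :
    dist (g ^ m • x) (g ^ n • x) = dist x (g ^ (m - n).natAbs • x) := by
  rcases le_total m n with h | h
  · obtain ⟨k, rfl⟩ := Int.le.dest h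
    rw [zpow_add, mul_smul, dist_smul, zpow_natCast]
    congr 3
    omega
  · obtain ⟨k, rfl⟩ := Int.le.dest h
    rw [zpow_add, mul_smul, dist_smul, zpow_natCast, dist_comm]
    congr 3
    omega

theorem isLoxodromic_of_le_dist {g : G} {x : X} {c : ℝ} (hc : 0 < c)
    (h : ∀ n : ℕ, c * n ≤ dist x (g ^ n • x)) : IsLoxodromic X g := by
  set L := max 1 (max (1 / c) (dist x (g • x))) with hL
  have h1 : 1 ≤ L := le_max_left _ _
  have h2 : 1 / c ≤ L := (le_max_left _ _).trans (le_max_right _ _)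
  have h3 : dist x (g • x) ≤ L := (le_max_right _ _).trans (le_max_right _ _)
  refine ⟨x, L, 0, h1, le_rfl, fun m n => ?_⟩
  have hab : |(m : ℝ) - n| = ((m - n).natAbs : ℝ) := by
    rw [Nat.cast_natAbs]; push_cast; rfl
  rw [dist_zpow_smul_zpow_smul, hab]
  have h4 := h (m - n).natAbs
  have h5 := dist_pow_smul_le g x (m - n).natAbs
  have h0 : (0 : ℝ) ≤ ((m - n).natAbs : ℝ) := Nat.cast_nonneg _
  generalize ((m - n).natAbs : ℝ) = k at *
  constructor
  · have : k / L ≤ c * k := by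
      rw [div_le_iff₀ (by linarith)]
      have : 1 ≤ c * L := by
        have := mul_le_mul_of_nonneg_left h2 hc.le
        rwa [mul_one_div_cancel hc.ne'] at this
      nlinarith
    linarith
  · nlinarith

/-- Subadditivity removes the additive constant: a single deficit below `c * n` is multiplied by `k`
at exponent `n * k` and eventually exceeds `C`. -/
theorem isLoxodromic_of_exists_le_dist {g : G} {x : X} {c C : ℝ} (hc : 0 < c)
    (h : ∀ n : ℕ, c * n - C ≤ dist x (g ^ n • x)) : IsLoxodromic X g := by
  refine isLoxodromic_of_le_dist hc (x := x) fun n => ?_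
  by_contra! hlt
  obtain ⟨k, hk⟩ := exists_nat_gt (C / (c * n - dist x (g ^ n • x)))
  rw [div_lt_iff₀ (by linarith)] at hk
  have h1 := h (n * k)
  have h2 := dist_pow_smul_le (g ^ n) x k
  rw [← pow_mul] at h2
  push_cast at h1
  nlinarith

theorem IsLoxodromic.pow {g : G} (h : IsLoxodromic X g) {k : ℕ} (hk : k ≠ 0) :
    IsLoxodromic X (g ^ k) := by
  obtain ⟨x, L, C, hL, hC, h⟩ := h.exists_le_dist
  have hL0 : 0 < L := by linarith
  refine isLoxodromic_of_exists_le_dist (x := x) (c := 1 / L) (C := C) (by positivity)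
    fun n => ?_
  rw [← pow_mul]
  refine le_trans ?_ (h (k * n))
  have h1 : (1 : ℝ) ≤ k := by exact_mod_cast Nat.one_le_iff_ne_zero.2 hk
  have h2 : (n : ℝ) / L ≤ ((k * n : ℕ) : ℝ) / L := by
    refine div_le_div_of_nonneg_right ?_ hL0.le
    push_cast
    nlinarith [(Nat.cast_nonneg n : (0 : ℝ) ≤ n)]
  rw [one_div_mul_eq_div]
  linarith

/-- If both factors fail to be loxodromic, each has a power with displacement below `1 / (4 * L)`
per unit of exponent. At common multiples the product then moves at rate at most `1 / (2 * L)`, half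
its guaranteed rate. -/
theorem IsLoxodromic.of_commute {p q : G} (hpq : Commute p q) (h : IsLoxodromic X (p * q)) :
    IsLoxodromic X p ∨ IsLoxodromic X q := by
  by_contra! hcon
  obtain ⟨x, L, C, hL, hC, h⟩ := h.exists_le_dist
  have hL0 : 0 < L := by linarith
  have key : ∀ g : G, ¬ IsLoxodromic X g →
      ∃ n : ℕ, n ≠ 0 ∧ ∀ k : ℕ, dist x (g ^ (n * k) • x) ≤ 1 / (4 * L) * (n * k) := by
    intro g hg
    have h1 : ¬ ∀ n : ℕ, 1 / (4 * L) * n ≤ dist x (g ^ n • x) :=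
      fun h' => hg (isLoxodromic_of_le_dist (by positivity) h')
    push Not at h1
    obtain ⟨n, hn⟩ := h1
    refine ⟨n, ?_, fun k => ?_⟩
    · rintro rfl
      simp at hn
    · have h2 := dist_pow_smul_le (g ^ n) x k
      rw [← pow_mul] at h2
      nlinarith [(Nat.cast_nonneg k : (0 : ℝ) ≤ k)]
  obtain ⟨a, ha0, ha⟩ := key p hcon.1
  obtain ⟨b, hb0, hb⟩ := key q hcon.2
  obtain ⟨k, hk⟩ := exists_nat_gt (2 * L * C)
  have h1 := h (a * (b * k))
  have h2 := ha (b * k)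
  have h3 := hb (a * k)
  rw [show b * (a * k) = a * (b * k) by ring] at h3
  have h4 := dist_triangle x (p ^ (a * (b * k)) • x) ((p * q) ^ (a * (b * k)) • x)
  rw [hpq.mul_pow, mul_smul, dist_smul] at h4
  rw [hpq.mul_pow, mul_smul] at h1
  have h5 : (1 : ℝ) ≤ (a : ℝ) * b := by
    exact_mod_cast Nat.one_le_iff_ne_zero.2 (mul_ne_zero ha0 hb0)
  have h6 : (k : ℝ) ≤ a * (b * k) := by
    nlinarith [(Nat.cast_nonneg k : (0 : ℝ) ≤ k)]
  push_cast at h1 h2 h3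
  have h7 : (a : ℝ) * (b * k) / L - C ≤ 1 / (2 * L) * (a * (b * k)) := by
    have : 1 / (2 * L) * ((a : ℝ) * (b * k)) =
      1 / (4 * L) * (a * (b * k)) + 1 / (4 * L) * (b * (a * k)) := by
      field_simp
      ring
    linarith
  generalize (a : ℝ) * (b * k) = t at *
  have h8 : t / L - 1 / (2 * L) * t = t / (2 * L) := by field_simp; ring
  have h9 : t / (2 * L) ≤ C := by linarith
  rw [div_le_iff₀ (by positivity)] at h9
  linarith

/-! ### From local growth of displacement to global growth and convergence. -/

section Growth

variable {δ a : ℝ} (hyp : ∀ o x y z : X,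
    min (gromovProduct o x y) (gromovProduct o y z) - δ ≤ gromovProduct o x z)
  {g : G} {x : X} (h : dist x (g • x) + 2 * δ + a ≤ dist x (g ^ 2 • x))

include hyp h

theorem dist_pow_smul_add_le (ha : 0 < a) (n : ℕ) :
    dist x (g ^ n • x) + a ≤ dist x (g ^ (n + 1) • x) := by
  induction n with
  | zero =>
    have h1 := dist_pow_smul_le g x 2
    -- At a single point the four-point condition reads `0 ≤ δ`.
    have h2 := hyp x x x x
    simp only [gromovProduct_self, dist_self, min_self] at h2
    push_cast at h1
    simp only [pow_zero, one_smul, dist_self, zero_add, pow_one]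
    linarith
  | succ n ih =>
    have h2 : dist (g ^ n • x) (g ^ (n + 1) • x) = dist x (g • x) := by
      rw [pow_succ, mul_smul, dist_smul]
    have h3 : dist (g ^ (n + 2) • x) (g ^ (n + 1) • x) = dist x (g • x) := by
      rw [pow_succ g (n + 1), mul_smul, dist_smul, dist_comm]
    have h4 : dist (g ^ n • x) (g ^ (n + 2) • x) = dist x (g ^ 2 • x) := by
      rw [pow_add, mul_smul, dist_smul]
    -- Based at `g ^ (n + 1) • x`, the step back and the step forward have a small product because
    -- `g ^ 2` moves `x` far. By induction the step back points towards `x`, so the step forward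
    -- points away from it.
    have h6 := hyp (g ^ (n + 1) • x) (g ^ n • x) x (g ^ (n + 2) • x)
    simp only [gromovProduct] at h6
    rw [dist_comm (g ^ (n + 1) • x) x, dist_comm (g ^ n • x) x,
      dist_comm (g ^ (n + 1) • x) (g ^ n • x),
      dist_comm (g ^ (n + 1) • x) (g ^ (n + 2) • x), h2, h3, h4] at h6
    rcases min_cases ((dist x (g • x) + dist x (g ^ (n + 1) • x) - dist x (g ^ n • x)) / 2)
      ((dist x (g ^ (n + 1) • x) + dist x (g • x) - dist x (g ^ (n + 2) • x)) / 2) with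
      h7 | h7
    · rw [h7.1] at h6
      linarith
    · rw [h7.1] at h6
      show _ ≤ dist x (g ^ (n + 2) • x)
      linarith

theorem mul_le_dist_pow_smul (ha : 0 < a) (n : ℕ) : a * n ≤ dist x (g ^ n • x) := by
  induction n with
  | zero => simp
  | succ n ih =>
    have := dist_pow_smul_add_le hyp h ha n
    push_cast
    linarith

/-- Orbit points lie uniformly near the geodesics between earlier and later ones. The condition `δ <
a` excludes the other branch of the minimum. -/
theorem gromovProduct_pow_smul_le (ha : δ < a) (ha0 : 0 < a) (m n : ℕ) :
    gromovProduct (g ^ m • x) x (g ^ (m + n) • x) ≤ dist x (g • x) / 2 + δ := by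
  have hδ : 0 ≤ δ := by
    have h2 := hyp x x x x
    simp only [gromovProduct_self, dist_self, min_self] at h2
    linarith
  rcases m with _ | m
  · simp only [pow_zero, one_smul, gromovProduct, dist_self]
    have : 0 ≤ dist x (g • x) := dist_nonneg
    linarith
  · have h1 := hyp (g ^ (m + 1) • x) (g ^ m • x) x (g ^ (m + 1 + n) • x)
    have e1 := dist_pow_smul_add_le hyp h ha0 n
    have e2 := dist_pow_smul_add_le hyp h ha0 m
    have d1 : dist (g ^ (m + 1) • x) (g ^ m • x) = dist x (g • x) := by
      rw [pow_succ, mul_smul, dist_smul, dist_comm]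
    have d2 : dist (g ^ (m + 1) • x) (g ^ (m + 1 + n) • x) = dist x (g ^ n • x) := by
      rw [pow_add g (m + 1) n, mul_smul, dist_smul]
    have d3 : dist (g ^ m • x) (g ^ (m + 1 + n) • x) = dist x (g ^ (n + 1) • x) := by
      rw [add_assoc, add_comm 1 n, pow_add, mul_smul, dist_smul]
    have f1 : gromovProduct (g ^ (m + 1) • x) (g ^ m • x) (g ^ (m + 1 + n) • x) ≤
        (dist x (g • x) - a) / 2 := by
      rw [gromovProduct, d1, d2, d3]
      linarith
    have f2 : (dist x (g • x) + a) / 2 ≤ gromovProduct (g ^ (m + 1) • x) (g ^ m • x) x := by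
      rw [gromovProduct, d1, dist_comm _ x, dist_comm _ x]
      linarith
    rcases min_cases (gromovProduct (g ^ (m + 1) • x) (g ^ m • x) x)
      (gromovProduct (g ^ (m + 1) • x) x (g ^ (m + 1 + n) • x)) with h7 | h7
    · rw [h7.1] at h1
      linarith
    · rw [h7.1] at h1
      linarith

theorem le_gromovProduct_pow_smul (ha : δ < a) (ha0 : 0 < a) {k m n : ℕ} (hm : k ≤ m)
    (hn : k ≤ n) :
    a * k - (dist x (g • x) / 2 + δ) ≤ gromovProduct x (g ^ m • x) (g ^ n • x) := by
  wlog hmn : m ≤ n generalizing m n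
  · rw [gromovProduct_comm]
    exact this hn hm (by omega)
  obtain ⟨n, rfl⟩ := Nat.exists_eq_add_of_le hmn
  have h1 := gromovProduct_pow_smul_le hyp h ha ha0 m n
  have h2 := mul_le_dist_pow_smul hyp h ha0 m
  have h3 : gromovProduct x (g ^ m • x) (g ^ (m + n) • x) =
      dist x (g ^ m • x) - gromovProduct (g ^ m • x) x (g ^ (m + n) • x) := by
    unfold gromovProduct
    rw [dist_comm (g ^ m • x) x]
    ring
  have h4 : (k : ℝ) ≤ m := by exact_mod_cast hm
  nlinarith

theorem convergesAtInfinity_pow_smul (ha : δ < a) (ha0 : 0 < a) :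
    ConvergesAtInfinity (fun n : ℕ => g ^ n • x) := by
  refine Asymptotic.of_exists_forall_le x fun b => ?_
  obtain ⟨k, hk⟩ := exists_nat_gt ((b + (dist x (g • x) / 2 + δ)) / a)
  rw [div_lt_iff₀ ha0] at hk
  refine ⟨k, fun m hm n hn => ?_⟩
  have := le_gromovProduct_pow_smul hyp h ha ha0 hm hn
  linarith

end Growth

end Action

/-! ### Poles, limit sets and the existence of loxodromic elements. -/

section BoundaryDynamics

variable {X : Type w} [MetricSpace X] [HyperbolicSpace X] {G : Type u} [Group G] [MulAction G X]

theorem mem_limitSet_iff {ξ : Boundary X} :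
    ξ ∈ limitSet G X ↔ ∃ (x : X) (g : ℕ → G), ConvergesTo (fun n => g n • x) ξ :=
  Iff.rfl

/-- `ξ` and `η` are the attracting and the repelling boundary point of `g`. -/
def HasPoles (g : G) (ξ η : Boundary X) : Prop :=
  ξ ≠ η ∧ ∃ N : ℕ, ∃ x : X, ConvergesTo (fun n : ℕ => (g ^ N) ^ n • x) ξ ∧
    ConvergesTo (fun n : ℕ => (g⁻¹ ^ N) ^ n • x) η

theorem HasPoles.inv {g : G} {ξ η : Boundary X} (h : HasPoles g ξ η) : HasPoles g⁻¹ η ξ := by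
  obtain ⟨hne, N, x, h1, h2⟩ := h
  exact ⟨hne.symm, N, x, h2, by simpa using h1⟩

theorem HasPoles.left_mem_limitSet {g : G} {ξ η : Boundary X} (h : HasPoles g ξ η) :
    ξ ∈ limitSet G X := by
  obtain ⟨hne, N, x, h1, h2⟩ := h
  exact mem_limitSet_iff.2 ⟨x, _, h1⟩

theorem HasPoles.right_mem_limitSet {g : G} {ξ η : Boundary X} (h : HasPoles g ξ η) :
    η ∈ limitSet G X :=
  h.inv.left_mem_limitSet

theorem isElementary_of_limitSet_subset_pair {ξ η : Boundary X} (hne : ξ ≠ η)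
    (h : limitSet G X ⊆ {ξ, η}) : IsElementary G X :=
  (encard_le_encard h).trans (encard_pair hne).le

theorem limitSet_eq_pair_of_isElementary (h : IsElementary G X) {g : G} {ξ η : Boundary X}
    (hp : HasPoles g ξ η) : limitSet G X = {ξ, η} := by
  have hsub : ({ξ, η} : Set (Boundary X)) ⊆ limitSet G X := by
    rintro θ (rfl | rfl)
    exacts [hp.left_mem_limitSet, hp.right_mem_limitSet]
  refine (Set.Finite.eq_of_subset_of_encard_le (toFinite _) hsub ?_).symm
  rw [encard_pair hp.1]
  exact h

variable [IsIsometricSMul G X]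

theorem ConvergesTo.smul {x : ℕ → X} {ξ : Boundary X} (h : ConvergesTo x ξ) (g : G) :
    ConvergesTo (fun n => g • x n) (g • ξ) := by
  obtain ⟨h, rfl⟩ := h
  exact ⟨Asymptotic.smul h g, rfl⟩

theorem smul_mem_limitSet {ξ : Boundary X} (h : ξ ∈ limitSet G X) (g : G) :
    g • ξ ∈ limitSet G X := by
  obtain ⟨x, k, hk⟩ := mem_limitSet_iff.1 h
  refine mem_limitSet_iff.2 ⟨x, fun n => g * k n, ?_⟩
  simpa only [mul_smul] using hk.smul g

theorem exists_convergesTo_of_mem_limitSet {ξ : Boundary X} (h : ξ ∈ limitSet G X) (o : X) :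
    ∃ g : ℕ → G, ConvergesTo (fun n => g n • o) ξ := by
  obtain ⟨x, g, hg⟩ := mem_limitSet_iff.1 h
  exact ⟨g, hg.of_dist_le (C := dist x o) fun n => (dist_smul _ _ _).le⟩

/-- A sequence of isometries preserving a pair of boundary points can move a point of `X`
only towards these two points. -/
theorem eq_or_eq_of_convergesTo {ξ η θ : Boundary X} (hne : ξ ≠ η) {k : ℕ → G} {o : X}
    (hk : ∀ n, (k n • ξ = ξ ∧ k n • η = η) ∨ (k n • ξ = η ∧ k n • η = ξ))
    (hθ : ConvergesTo (fun n => k n • o) θ) : θ = ξ ∨ θ = η := by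
  by_contra! hcon
  obtain ⟨x, hx⟩ := exists_convergesTo ξ
  obtain ⟨y, hy⟩ := exists_convergesTo η
  obtain ⟨C, hC⟩ := exists_gromovProduct_le_of_not_asymptotic
    (fun h' => hne ((hx.eq_iff hy).2 h')) o
  obtain ⟨D, N₁, hD⟩ := exists_gromovProduct_le_of_ne hx hθ hcon.1.symm o
  obtain ⟨E, N₂, hE⟩ := exists_gromovProduct_le_of_ne hy hθ hcon.2.symm o
  obtain ⟨N₃, hN₃⟩ := hθ.exists_lt_dist o (C + D + E)
  set n := max N₁ (max N₂ N₃) with hn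
  have n1 : N₁ ≤ n := le_max_left _ _
  have n2 : N₂ ≤ n := (le_max_left _ _).trans (le_max_right _ _)
  have n3 : N₃ ≤ n := (le_max_right _ _).trans (le_max_right _ _)
  -- Moving the base point back to `o` replaces `x`, `y` by sequences converging to the same pair,
  -- possibly swapped, so `C` works for every `n`.
  have hbase : ∃ N : ℕ, ∀ i ≥ N, ∀ j ≥ N, gromovProduct (k n • o) (x i) (y j) ≤ C := by
    have e : ∀ i j, gromovProduct (k n • o) (x i) (y j) =
        gromovProduct o ((k n)⁻¹ • x i) ((k n)⁻¹ • y j) := fun i j => by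
      rw [← gromovProduct_smul (k n) o, smul_inv_smul, smul_inv_smul]
    have hx' := hx.smul (k n)⁻¹
    have hy' := hy.smul (k n)⁻¹
    simp only [e]
    rcases hk n with ⟨h1, h2⟩ | ⟨h1, h2⟩
    · rw [inv_smul_eq_iff.2 h1.symm] at hx'
      rw [inv_smul_eq_iff.2 h2.symm] at hy'
      exact hC _ _ ((hx.eq_iff hx').1 rfl) ((hy.eq_iff hy').1 rfl)
    · rw [inv_smul_eq_iff.2 h2.symm] at hx'
      rw [inv_smul_eq_iff.2 h1.symm] at hy'
      obtain ⟨N, hN⟩ := hC _ _ ((hx.eq_iff hy').1 rfl) ((hy.eq_iff hx').1 rfl)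
      exact ⟨N, fun i hi j hj => by rw [gromovProduct_comm]; exact hN j hj i hi⟩
  obtain ⟨N, hN⟩ := hbase
  set i := max N (max N₁ N₂) with hi
  have i1 : N ≤ i := le_max_left _ _
  have i2 : N₁ ≤ i := (le_max_left _ _).trans (le_max_right _ _)
  have i3 : N₂ ≤ i := (le_max_right _ _).trans (le_max_right _ _)
  have f1 := hN i i1 i i1
  have f2 := hD i i2 n n1
  have f3 := hE i i3 n n2
  have f4 := hN₃ n n3
  -- The product based at `k n • o` is at least `dist o (k n • o) - D - E`, which exceeds `C`.
  rw [gromovProduct_change_base o] at f1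
  have f5 := gromovProduct_nonneg o (x i) (y i)
  linarith

theorem isElementary_of_pair_invariant {ξ η : Boundary X} (hne : ξ ≠ η)
    (h : ∀ g : G, (g • ξ = ξ ∧ g • η = η) ∨ (g • ξ = η ∧ g • η = ξ)) : IsElementary G X := by
  refine isElementary_of_limitSet_subset_pair hne fun θ hθ => ?_
  obtain ⟨x, k, hk⟩ := mem_limitSet_iff.1 hθ
  exact eq_or_eq_of_convergesTo hne (fun n => h (k n)) hk

theorem smul_pair {ξ η : Boundary X} (hne : ξ ≠ η) {g : G} (h1 : g • ξ = ξ ∨ g • ξ = η)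
    (h2 : g • η = ξ ∨ g • η = η) : (g • ξ = ξ ∧ g • η = η) ∨ (g • ξ = η ∧ g • η = ξ) := by
  have : g • ξ ≠ g • η := fun h => hne (MulAction.injective g h)
  grind

theorem HasPoles.smul_left_eq_of_commute {g c : G} {ξ η : Boundary X} (h : HasPoles g ξ η)
    (hc : Commute c g) : c • ξ = ξ := by
  obtain ⟨hne, N, x, h1, h2⟩ := h
  refine (h1.smul c).unique (h1.of_dist_le (C := dist x (c • x)) fun n => ?_)
  rw [← mul_smul, ((hc.pow_right N).pow_right n).eq, mul_smul, dist_smul]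

theorem HasPoles.smul_right_eq_of_commute {g c : G} {ξ η : Boundary X} (h : HasPoles g ξ η)
    (hc : Commute c g) : c • η = η :=
  h.inv.smul_left_eq_of_commute hc.inv_right

theorem HasPoles.conj {g : G} {ξ η : Boundary X} (h : HasPoles g ξ η) (c : G) :
    HasPoles (c * g * c⁻¹) (c • ξ) (c • η) := by
  obtain ⟨hne, N, x, h1, h2⟩ := h
  refine ⟨fun h => hne (MulAction.injective c h), N, c • x, ?_, ?_⟩
  · convert h1.smul c using 2 with n
    rw [conj_pow, conj_pow, mul_smul, inv_smul_smul, mul_smul]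
  · convert h2.smul c using 2 with n
    rw [show (c * g * c⁻¹)⁻¹ = c * g⁻¹ * c⁻¹ by group, conj_pow, conj_pow, mul_smul,
      inv_smul_smul, mul_smul]

/-- Were `ζ` a third fixed point, powers of `g` would fix the pair `ζ`, `η`, so their orbits could
converge only to one of these and not to `ξ`. -/
theorem HasPoles.eq_or_eq_of_smul_eq {g : G} {ξ η ζ : Boundary X} (h : HasPoles g ξ η)
    (hζ : g • ζ = ζ) : ζ = ξ ∨ ζ = η := by
  by_contra! hcon
  have hη := h.smul_right_eq_of_commute (Commute.refl g)
  obtain ⟨hne, N, x, h1, h2⟩ := h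
  have stab : ∀ {θ : Boundary X}, g • θ = θ → ∀ n : ℕ, (g ^ N) ^ n • θ = θ := by
    intro θ hθ n
    have : g ∈ MulAction.stabilizer G θ := hθ
    exact pow_mem (pow_mem this N) n
  rcases eq_or_eq_of_convergesTo hcon.2 (fun n => Or.inl ⟨stab hζ n, stab hη n⟩) h1 with h | h
  · exact hcon.1 h.symm
  · exact hne h

theorem IsLoxodromic.exists_hasPoles {g : G} (h : IsLoxodromic X g) :
    ∃ ξ η : Boundary X, HasPoles g ξ η := by
  obtain ⟨δ, hδ, hyp⟩ := exists_hyperbolicity_constant X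
  -- The growth lemmas are applied with `a = δ + 1`, which satisfies both `δ < a` and `0 < a`.
  obtain ⟨N, x, hx⟩ := h.exists_dist_add_le (2 * δ + (δ + 1))
  have hx' : dist x (g ^ N • x) + 2 * δ + (δ + 1) ≤ dist x ((g ^ N) ^ 2 • x) := by linarith
  have hinv : ∀ n : ℕ, dist x ((g⁻¹ ^ N) ^ n • x) = dist x ((g ^ N) ^ n • x) := fun n => by
    rw [dist_comm, dist_smul_eq_dist_inv_smul, inv_pow, inv_pow]
  have hy : dist x (g⁻¹ ^ N • x) + 2 * δ + (δ + 1) ≤ dist x ((g⁻¹ ^ N) ^ 2 • x) := by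
    rw [hinv 2]
    have := hinv 1
    rw [pow_one, pow_one] at this
    rw [this]
    exact hx'
  have c1 := convergesAtInfinity_pow_smul hyp hx' (by linarith) (by linarith)
  have c2 := convergesAtInfinity_pow_smul hyp hy (by linarith) (by linarith)
  refine ⟨_, _, fun heq => ?_, N, x, ⟨c1, rfl⟩, ⟨c2, rfl⟩⟩
  obtain ⟨n, hn⟩ := Asymptotic.exists_forall_le (Quotient.exact heq) x
    (dist x (g ^ N • x) / 2 + δ + 1)
  have h1 := hn n le_rfl n le_rfl
  have h2 := gromovProduct_pow_smul_le hyp hx' (by linarith) (by linarith) n n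
  -- Translated to base point `x`, this bounds the product of the forward and backward orbits, so
  -- the two poles differ.
  rw [← gromovProduct_smul (((g ^ N) ^ n)⁻¹), inv_smul_smul, pow_add, mul_smul, inv_smul_smul,
    gromovProduct_comm, ← inv_pow, ← inv_pow] at h2
  dsimp only at h1
  linarith

/-- Take long `g`, `h` moving `o` in different directions. A non-loxodromic element sends `o` in
nearly the same direction as its inverse does. If `g`, `h` and `g * h` were all such, then `g • o`,
`(g * h) • o`, `(g * h)⁻¹ • o` and `h⁻¹ • o` would successively be close in direction, while `g • o`
and `h⁻¹ • o` are not. -/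
theorem exists_isLoxodromic {ξ η : Boundary X} (hξ : ξ ∈ limitSet G X) (hη : η ∈ limitSet G X)
    (hne : ξ ≠ η) : ∃ g : G, IsLoxodromic X g := by
  by_contra! hcon
  obtain ⟨δ, hδ, hyp⟩ := exists_hyperbolicity_constant X
  obtain ⟨o⟩ := HyperbolicSpace.nonempty (X := X)
  obtain ⟨u, hu⟩ := exists_convergesTo_of_mem_limitSet hξ o
  obtain ⟨v, hv⟩ := exists_convergesTo_of_mem_limitSet hη o
  obtain ⟨C, N, hC⟩ := exists_gromovProduct_le_of_ne hu hv hne o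
  have nonlox : ∀ g : G, dist o (g ^ 2 • o) < dist o (g • o) + 2 * δ + 1 := fun g => by
    by_contra! h
    exact hcon g (isLoxodromic_of_le_dist one_pos (mul_le_dist_pow_smul hyp h one_pos))
  have hinv : ∀ g : G, dist o (g⁻¹ • o) = dist o (g • o) := fun g => by
    rw [dist_smul_eq_dist_inv_smul, inv_inv, dist_comm]
  have hprod : ∀ g h : G, gromovProduct o (g⁻¹ • o) (h • o) =
      (dist o (g • o) + dist o (h • o) - dist o ((g * h) • o)) / 2 := fun g h => by
    rw [gromovProduct, hinv, ← dist_smul_eq_dist_inv_smul, ← mul_smul]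
  set R := 4 * C + 20 * δ + 20 with hR
  obtain ⟨N₁, h1⟩ := hu.exists_lt_dist o R
  obtain ⟨N₂, h2⟩ := hv.exists_lt_dist o R
  set n := max N (max N₁ N₂) with hn
  have hgh := hC n (le_max_left _ _) n (le_max_left _ _)
  have hg := h1 n ((le_max_left _ _).trans (le_max_right _ _))
  have hh := h2 n ((le_max_right _ _).trans (le_max_right _ _))
  generalize u n = g at *
  generalize v n = h at *
  have hC0 : 0 ≤ C := (gromovProduct_nonneg _ _ _).trans hgh
  have g1 : R / 2 - δ - 1 / 2 ≤ gromovProduct o (g⁻¹ • o) (g • o) := by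
    have := nonlox g
    rw [hprod, ← pow_two]
    linarith
  have g2 : R / 2 - δ - 1 / 2 ≤ gromovProduct o (h⁻¹ • o) (h • o) := by
    have := nonlox h
    rw [hprod, ← pow_two]
    linarith
  have g3 : gromovProduct o (g⁻¹ • o) (h • o) ≤ C + δ := by
    have := hyp o (g • o) (g⁻¹ • o) (h • o)
    rw [gromovProduct_comm o (g • o) (g⁻¹ • o)] at this
    rcases min_cases (gromovProduct o (g⁻¹ • o) (g • o)) (gromovProduct o (g⁻¹ • o) (h • o)) with
      h7 | h7 <;> rw [h7.1] at this <;> linarith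
  have g4 : gromovProduct o (g • o) (h⁻¹ • o) ≤ C + δ := by
    have := hyp o (g • o) (h⁻¹ • o) (h • o)
    rcases min_cases (gromovProduct o (g • o) (h⁻¹ • o)) (gromovProduct o (h⁻¹ • o) (h • o)) with
      h7 | h7 <;> rw [h7.1] at this <;> linarith
  have p1 := hprod g h
  have p2 := nonlox (g * h)
  have p3 := hprod (g * h) (g * h)
  rw [← pow_two (g * h)] at p3
  have p4 : gromovProduct o (g • o) ((g * h) • o) =
      (dist o (g • o) + dist o ((g * h) • o) - dist o (h • o)) / 2 := by
    rw [gromovProduct, mul_smul, dist_smul]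
  have p5 : gromovProduct o ((g * h)⁻¹ • o) (h⁻¹ • o) =
      (dist o ((g * h) • o) + dist o (h • o) - dist o (g • o)) / 2 := by
    rw [gromovProduct, hinv, hinv, mul_inv_rev, mul_smul h⁻¹, dist_smul, dist_comm (g⁻¹ • o), hinv]
  have p6 := hyp o (g • o) ((g * h) • o) ((g * h)⁻¹ • o)
  have p7 := hyp o (g • o) ((g * h)⁻¹ • o) (h⁻¹ • o)
  rw [gromovProduct_comm o ((g * h) • o)] at p6
  rcases min_cases (gromovProduct o (g • o) ((g * h) • o))
    (gromovProduct o ((g * h)⁻¹ • o) ((g * h) • o)) with h7 | h7 <;> rw [h7.1] at p6 <;>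
  rcases min_cases (gromovProduct o (g • o) ((g * h)⁻¹ • o))
    (gromovProduct o ((g * h)⁻¹ • o) (h⁻¹ • o)) with h8 | h8 <;> rw [h8.1] at p7 <;>
  linarith

theorem exists_isLoxodromic_of_not_isElementary (h : ¬ IsElementary G X) :
    ∃ g : G, IsLoxodromic X g := by
  have h1 : 1 < (limitSet G X).encard := lt_of_lt_of_le (by norm_num) (not_le.1 h).le
  obtain ⟨ξ, η, hξ, hη, hne⟩ := one_lt_encard_iff.1 h1
  exact exists_isLoxodromic hξ hη hne

/-- Two elements witnessing that an action is non-elementary. -/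
theorem exists_hasPoles_and_smul_notMem (h : ¬ IsElementary G X) :
    ∃ (g c : G) (ξ η : Boundary X), HasPoles g ξ η ∧
      ¬ ((c • ξ = ξ ∨ c • ξ = η) ∧ (c • η = ξ ∨ c • η = η)) := by
  obtain ⟨g, hg⟩ := exists_isLoxodromic_of_not_isElementary h
  obtain ⟨ξ, η, hp⟩ := hg.exists_hasPoles
  by_contra! hcon
  refine h (isElementary_of_pair_invariant hp.1 fun c => ?_)
  obtain ⟨h1, h2⟩ := hcon g c ξ η hp
  exact smul_pair hp.1 h1 h2

/-- The limit set is invariant, so `c` sends one of the poles to a third limit point. -/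
theorem not_isElementary_of_hasPoles {g c : G} {ξ η : Boundary X} (hp : HasPoles g ξ η)
    (hc : ¬ ((c • ξ = ξ ∨ c • ξ = η) ∧ (c • η = ξ ∨ c • η = η))) : ¬ IsElementary G X := by
  have key : ∀ ζ ∈ limitSet G X, ζ ≠ ξ → ζ ≠ η → ¬ IsElementary G X := by
    intro ζ hζ h1 h2 hel
    have hsub : ({ζ, ξ, η} : Set (Boundary X)) ⊆ limitSet G X := by
      rintro θ (rfl | rfl | rfl)
      exacts [hζ, hp.left_mem_limitSet, hp.right_mem_limitSet]
    have h3 := (encard_le_encard hsub).trans hel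
    rw [encard_eq_three.2 ⟨ζ, ξ, η, h1, h2, hp.1, rfl⟩] at h3
    exact absurd h3 (by norm_num)
  rw [not_and_or] at hc
  rcases hc with hc | hc
  · push Not at hc
    exact key _ (smul_mem_limitSet hp.left_mem_limitSet c) hc.1 hc.2
  · push Not at hc
    exact key _ (smul_mem_limitSet hp.right_mem_limitSet c) hc.1 hc.2

end BoundaryDynamics

/-! ### Comparing actions along a homomorphism; normal subgroups. -/

section Compatible

variable {X : Type w} [MetricSpace X] {A G : Type u} [Group A] [Group G] [MulAction A X]
  [MulAction G X] {f : A →* G} (hf : ∀ (a : A) (x : X), f a • x = a • x)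

include hf

theorem isLoxodromic_map_iff {a : A} : IsLoxodromic X (f a) ↔ IsLoxodromic X a := by
  simp only [IsLoxodromic, ← map_zpow, hf]

variable [HyperbolicSpace X]

theorem limitSet_subset_of_hom : limitSet A X ⊆ limitSet G X := by
  intro ξ hξ
  obtain ⟨x, g, hg⟩ := mem_limitSet_iff.1 hξ
  exact mem_limitSet_iff.2 ⟨x, fun n => f (g n), by simpa only [hf] using hg⟩

theorem limitSet_eq_of_surjective (hsurj : Function.Surjective f) :
    limitSet A X = limitSet G X := by
  refine (limitSet_subset_of_hom hf).antisymm fun ξ hξ => ?_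
  obtain ⟨x, g, hg⟩ := mem_limitSet_iff.1 hξ
  choose s hs using hsurj
  exact mem_limitSet_iff.2 ⟨x, fun n => s (g n), by simpa only [← hf, hs] using hg⟩

theorem IsElementary.of_hom (h : IsElementary G X) : IsElementary A X :=
  (encard_le_encard (limitSet_subset_of_hom hf)).trans h

theorem isElementary_iff_of_surjective (hsurj : Function.Surjective f) :
    IsElementary A X ↔ IsElementary G X := by
  rw [IsElementary, limitSet_eq_of_surjective hf hsurj, IsElementary]

variable [IsIsometricSMul A X] [IsIsometricSMul G X]

theorem hom_smul_boundary (a : A) (ξ : Boundary X) : f a • ξ = a • ξ := by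
  obtain ⟨x, hx⟩ := exists_convergesTo ξ
  have h := hx.smul (f a)
  simp only [hf] at h
  exact h.unique (hx.smul a)

theorem IsGeneralType.of_hom (h : IsGeneralType A X) : IsGeneralType G X := by
  refine ⟨fun h' => h.1 (h'.of_hom hf), fun ⟨ξ, hξ⟩ => h.2 ⟨ξ, fun a => ?_⟩⟩
  rw [← hom_smul_boundary hf, hξ]

theorem isGeneralType_iff_of_surjective (hsurj : Function.Surjective f) :
    IsGeneralType A X ↔ IsGeneralType G X := by
  refine ⟨fun h => h.of_hom hf, fun h => ⟨fun h' => h.1 ?_, fun ⟨ξ, hξ⟩ => h.2 ⟨ξ, fun g => ?_⟩⟩⟩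
  · exact (isElementary_iff_of_surjective hf hsurj).1 h'
  · obtain ⟨a, rfl⟩ := hsurj g
    rw [hom_smul_boundary hf, hξ]

/-- A normal subgroup containing a loxodromic element acts elementarily only if the whole group
does. -/
theorem isElementary_of_normal_range (hn : f.range.Normal) {a : A} (ha : IsLoxodromic X a)
    (h : IsElementary A X) : IsElementary G X := by
  obtain ⟨ξ, η, hp⟩ := ha.exists_hasPoles
  have hpair := limitSet_eq_pair_of_isElementary h hp
  -- Normality makes the limit set of `A` invariant under `G`; that set is just the pole pair of
  -- `a`.
  have hinv : ∀ (g : G) (ζ : Boundary X), ζ ∈ limitSet A X → g • ζ ∈ limitSet A X := by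
    intro g ζ hζ
    obtain ⟨x, k, hk⟩ := mem_limitSet_iff.1 hζ
    have hex : ∀ n, ∃ b : A, f b = g * f (k n) * g⁻¹ := fun n => hn.conj_mem _ ⟨k n, rfl⟩ g
    choose b hb using hex
    refine mem_limitSet_iff.2 ⟨g • x, b, ?_⟩
    convert hk.smul g using 2 with n
    rw [← hf, hb, mul_smul, inv_smul_smul, mul_smul, hf]
  refine isElementary_of_pair_invariant hp.1 fun g => ?_
  have h1 := hinv g ξ hp.left_mem_limitSet
  have h2 := hinv g η hp.right_mem_limitSet
  rw [hpair] at h1 h2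
  exact smul_pair hp.1 h1 h2

/-- A normal subgroup containing a loxodromic element of an action of general type acts with
general type. -/
theorem IsGeneralType.of_normal_range (hn : f.range.Normal) {a : A} (ha : IsLoxodromic X a)
    (h : IsGeneralType G X) : IsGeneralType A X := by
  have hne : ¬ IsElementary A X := fun h' => h.1 (isElementary_of_normal_range hf hn ha h')
  refine ⟨hne, fun ⟨ξ, hξ⟩ => h.2 ⟨ξ, fun g => ?_⟩⟩
  -- By normality the translates of an `A`-fixed point are `A`-fixed. Two distinct ones would make
  -- the action of `A` elementary.
  have hfix : ∀ b : A, b • (g • ξ) = g • ξ := by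
    intro b
    obtain ⟨c, hc⟩ : ∃ c : A, f c = g⁻¹ * f b * g := by
      simpa using hn.conj_mem _ ⟨b, rfl⟩ g⁻¹
    have : f b * g = g * f c := by rw [hc]; group
    rw [← hom_smul_boundary hf, ← mul_smul, this, mul_smul, hom_smul_boundary hf, hξ]
  by_contra hcon
  exact hne (isElementary_of_pair_invariant hcon fun b => Or.inl ⟨hfix b, hξ b⟩)

end Compatible

/-! ### Finite witnesses for the type of an action. -/

section Subgroups

variable {X : Type w} [MetricSpace X] {G : Type u} [Group G] [MulAction G X]
  [IsIsometricSMul G X]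

instance isIsometricSMul_subgroup (H : Subgroup G) : IsIsometricSMul H X :=
  ⟨fun c => isometry_smul X (c : G)⟩

theorem IsLoxodromic.exists_mem_of_finiteIndex {g : G} (h : IsLoxodromic X g) (K : Subgroup G)
    [K.Normal] [K.FiniteIndex] : ∃ k : K, IsLoxodromic X k := by
  refine ⟨⟨g ^ K.index, K.pow_index_mem g⟩, ?_⟩
  exact (isLoxodromic_map_iff (f := K.subtype) (fun _ _ => rfl)).1
    (h.pow Subgroup.FiniteIndex.index_ne_zero)

variable [HyperbolicSpace X]

theorem exists_forall_subgroup_not_isElementary (h : ¬ IsElementary G X) :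
    ∃ s : Set G, s.Finite ∧ ∀ H : Subgroup G, s ⊆ H → ¬ IsElementary H X := by
  obtain ⟨g, c, ξ, η, hp, hc⟩ := exists_hasPoles_and_smul_notMem h
  refine ⟨{g, c}, toFinite _, fun H hs => ?_⟩
  have hg : g ∈ H := hs (by simp)
  have hcH : c ∈ H := hs (by simp)
  exact not_isElementary_of_hasPoles (g := (⟨g, hg⟩ : H)) (c := ⟨c, hcH⟩) hp hc

/-- A point fixed by a subgroup containing `g` is a pole of `g`, so it suffices to add one element
moving each pole. -/
theorem exists_forall_subgroup_isGeneralType (h : IsGeneralType G X) :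
    ∃ s : Set G, s.Finite ∧ ∀ H : Subgroup G, s ⊆ H → IsGeneralType H X := by
  obtain ⟨g, c, ξ, η, hp, hc⟩ := exists_hasPoles_and_smul_notMem h.1
  have hfix := h.2
  push Not at hfix
  obtain ⟨k, hk⟩ := hfix ξ
  obtain ⟨l, hl⟩ := hfix η
  refine ⟨{g, c, k, l}, toFinite _, fun H hs => ⟨?_, ?_⟩⟩
  · have hg : g ∈ H := hs (by simp)
    have hcH : c ∈ H := hs (by simp)
    exact not_isElementary_of_hasPoles (g := (⟨g, hg⟩ : H)) (c := ⟨c, hcH⟩) hp hc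
  · rintro ⟨ζ, hζ⟩
    have hζ' : ∀ a ∈ H, a • ζ = ζ := fun a ha =>
      (hom_smul_boundary (f := H.subtype) (fun _ _ => rfl) ⟨a, ha⟩ ζ).trans (hζ _)
    rcases hp.eq_or_eq_of_smul_eq (hζ' g (hs (by simp))) with rfl | rfl
    · exact hk (hζ' k (hs (by simp)))
    · exact hl (hζ' l (hs (by simp)))

end Subgroups

theorem exists_mem_finite_subset {G : Type u} [Group G] {F : Set (Subgroup G)} (hne : F.Nonempty)
    (hdir : DirectedOn (· ≤ ·) F) (hcov : ∀ g : G, ∃ H ∈ F, g ∈ H) {s : Set G} (hs : s.Finite) :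
    ∃ H ∈ F, s ⊆ H := by
  induction s, hs using Set.Finite.induction_on with
  | empty =>
    obtain ⟨H, hH⟩ := hne
    exact ⟨H, hH, empty_subset _⟩
  | @insert a s _ _ ih =>
    obtain ⟨H, hH, hsub⟩ := ih
    obtain ⟨K, hK, ha⟩ := hcov a
    obtain ⟨L, hL, h1, h2⟩ := hdir H hH K hK
    exact ⟨L, hL, insert_subset (h2 ha) (hsub.trans h1)⟩

/-- `P` passes from two groups to their product. -/
def PreservedByProducts (P : GroupProperty.{u}) : Prop :=
  ∀ (A B : Type u) [Group A] [Group B], P A → P B → P (A × B)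

/-- `P` passes from finite-index subgroups to the whole group. -/
def PreservedByFiniteExtensions (P : GroupProperty.{u}) : Prop :=
  ∀ (G : Type u) [Group G] (K : Subgroup G), K.FiniteIndex → P K → P G

/-- `P` holds for trivial groups. -/
def HoldsForTrivial (P : GroupProperty.{u}) : Prop :=
  ∀ (G : Type u) [Group G], Subsingleton G → P G

/-! ### Closure properties of (NL), (NNE) and (NGT). -/

section Properties

theorem NL.quotients : PreservedByQuotients NL.{u, w} := by
  intro G Q _ _ f hf h X _ _ _ _ q hq
  obtain ⟨g, rfl⟩ := hf q
  let := MulAction.compHom X f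
  have : IsIsometricSMul G X := ⟨fun c => isometry_smul X (f c)⟩
  exact h X g ((isLoxodromic_map_iff (f := f) fun _ _ => rfl).1 hq)

theorem NNE.quotients : PreservedByQuotients NNE.{u, w} := by
  intro G Q _ _ f hf h X _ _ _ _
  let := MulAction.compHom X f
  have : IsIsometricSMul G X := ⟨fun c => isometry_smul X (f c)⟩
  exact (isElementary_iff_of_surjective (f := f) (fun _ _ => rfl) hf).1 (h X)

theorem NGT.quotients : PreservedByQuotients NGT.{u, w} := by
  intro G Q _ _ f hf h X _ _ _ _ hX
  let := MulAction.compHom X f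
  have : IsIsometricSMul G X := ⟨fun c => isometry_smul X (f c)⟩
  exact h X ((isGeneralType_iff_of_surjective (f := f) (fun _ _ => rfl) hf).2 hX)

theorem NL.directedUnions : PreservedByDirectedUnions NL.{u, w} := by
  intro G _ F hne hdir hcov h X _ _ _ _ g hg
  obtain ⟨H, hH, hgH⟩ := hcov g
  exact h H hH X ⟨g, hgH⟩
    ((isLoxodromic_map_iff (f := H.subtype) (a := ⟨g, hgH⟩) fun _ _ => rfl).1 hg)

theorem NNE.directedUnions : PreservedByDirectedUnions NNE.{u, w} := by
  intro G _ F hne hdir hcov h X _ _ _ _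
  by_contra hX
  obtain ⟨s, hs, hs'⟩ := exists_forall_subgroup_not_isElementary hX
  obtain ⟨H, hH, hsH⟩ := exists_mem_finite_subset hne hdir hcov hs
  exact hs' H hsH (h H hH X)

theorem NGT.directedUnions : PreservedByDirectedUnions NGT.{u, w} := by
  intro G _ F hne hdir hcov h X _ _ _ _ hX
  obtain ⟨s, hs, hs'⟩ := exists_forall_subgroup_isGeneralType hX
  obtain ⟨H, hH, hsH⟩ := exists_mem_finite_subset hne hdir hcov hs
  exact h H hH X (hs' H hsH)

theorem isLoxodromic_inl_or_inr {X : Type w} [MetricSpace X] {A B : Type u} [Group A] [Group B]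
    [MulAction (A × B) X] [IsIsometricSMul (A × B) X] {g : A × B} (h : IsLoxodromic X g) :
    IsLoxodromic X (MonoidHom.inl A B g.1) ∨ IsLoxodromic X (MonoidHom.inr A B g.2) :=
  IsLoxodromic.of_commute (MonoidHom.commute_inl_inr g.1 g.2) (by simpa using h)

theorem normal_range_inl (A B : Type u) [Group A] [Group B] :
    (MonoidHom.inl A B).range.Normal := by
  refine ⟨?_⟩
  rintro _ ⟨a, rfl⟩ g
  exact ⟨g.1 * a * g.1⁻¹, by ext <;> simp⟩

theorem normal_range_inr (A B : Type u) [Group A] [Group B] :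
    (MonoidHom.inr A B).range.Normal := by
  refine ⟨?_⟩
  rintro _ ⟨a, rfl⟩ g
  exact ⟨g.2 * a * g.2⁻¹, by ext <;> simp⟩

theorem NL.products : PreservedByProducts NL.{u, w} := by
  intro A B _ _ hA hB X _ _ _ _ g hg
  rcases isLoxodromic_inl_or_inr hg with h | h
  · let := MulAction.compHom X (MonoidHom.inl A B)
    have : IsIsometricSMul A X := ⟨fun c => isometry_smul X (MonoidHom.inl A B c)⟩
    exact hA X _ ((isLoxodromic_map_iff fun _ _ => rfl).1 h)
  · let := MulAction.compHom X (MonoidHom.inr A B)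
    have : IsIsometricSMul B X := ⟨fun c => isometry_smul X (MonoidHom.inr A B c)⟩
    exact hB X _ ((isLoxodromic_map_iff fun _ _ => rfl).1 h)

theorem NNE.products : PreservedByProducts NNE.{u, w} := by
  intro A B _ _ hA hB X _ _ _ _
  by_contra hX
  obtain ⟨g, hg⟩ := exists_isLoxodromic_of_not_isElementary hX
  rcases isLoxodromic_inl_or_inr hg with h | h
  · let := MulAction.compHom X (MonoidHom.inl A B)
    have : IsIsometricSMul A X := ⟨fun c => isometry_smul X (MonoidHom.inl A B c)⟩
    exact hX (isElementary_of_normal_range (fun _ _ => rfl) (normal_range_inl A B)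
      ((isLoxodromic_map_iff fun _ _ => rfl).1 h) (hA X))
  · let := MulAction.compHom X (MonoidHom.inr A B)
    have : IsIsometricSMul B X := ⟨fun c => isometry_smul X (MonoidHom.inr A B c)⟩
    exact hX (isElementary_of_normal_range (fun _ _ => rfl) (normal_range_inr A B)
      ((isLoxodromic_map_iff fun _ _ => rfl).1 h) (hB X))

theorem NGT.products : PreservedByProducts NGT.{u, w} := by
  intro A B _ _ hA hB X _ _ _ _ hX
  obtain ⟨g, hg⟩ := exists_isLoxodromic_of_not_isElementary hX.1
  rcases isLoxodromic_inl_or_inr hg with h | h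
  · let := MulAction.compHom X (MonoidHom.inl A B)
    have : IsIsometricSMul A X := ⟨fun c => isometry_smul X (MonoidHom.inl A B c)⟩
    exact hA X (hX.of_normal_range (fun _ _ => rfl) (normal_range_inl A B)
      ((isLoxodromic_map_iff fun _ _ => rfl).1 h))
  · let := MulAction.compHom X (MonoidHom.inr A B)
    have : IsIsometricSMul B X := ⟨fun c => isometry_smul X (MonoidHom.inr A B c)⟩
    exact hB X (hX.of_normal_range (fun _ _ => rfl) (normal_range_inr A B)
      ((isLoxodromic_map_iff fun _ _ => rfl).1 h))

theorem NL.finiteExtensions : PreservedByFiniteExtensions NL.{u, w} := by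
  intro G _ K hK h X _ _ _ _ g hg
  obtain ⟨k, hk⟩ := hg.exists_mem_of_finiteIndex K.normalCore
  have hk' : IsLoxodromic X (k : G) :=
    (isLoxodromic_map_iff (f := K.normalCore.subtype) fun _ _ => rfl).2 hk
  exact h X ⟨k, K.normalCore_le k.2⟩
    ((isLoxodromic_map_iff (f := K.subtype) (a := ⟨k, K.normalCore_le k.2⟩) fun _ _ => rfl).1 hk')

theorem NNE.finiteExtensions : PreservedByFiniteExtensions NNE.{u, w} := by
  intro G _ K hK h X _ _ _ _
  by_contra hX
  obtain ⟨g, hg⟩ := exists_isLoxodromic_of_not_isElementary hX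
  obtain ⟨k, hk⟩ := hg.exists_mem_of_finiteIndex K.normalCore
  refine hX (isElementary_of_normal_range (f := K.normalCore.subtype) (fun _ _ => rfl) ?_ hk ?_)
  · rw [Subgroup.range_subtype]
    infer_instance
  · exact (h X).of_hom (f := Subgroup.inclusion K.normalCore_le) fun _ _ => rfl

theorem NGT.finiteExtensions : PreservedByFiniteExtensions NGT.{u, w} := by
  intro G _ K hK h X _ _ _ _ hX
  obtain ⟨g, hg⟩ := exists_isLoxodromic_of_not_isElementary hX.1
  obtain ⟨k, hk⟩ := hg.exists_mem_of_finiteIndex K.normalCore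
  refine h X (IsGeneralType.of_hom (f := Subgroup.inclusion K.normalCore_le) (fun _ _ => rfl)
    (hX.of_normal_range (f := K.normalCore.subtype) (fun _ _ => rfl) ?_ hk))
  rw [Subgroup.range_subtype]
  infer_instance

theorem NL.nne {G : Type u} [Group G] (h : NL.{u, w} G) : NNE.{u, w} G := by
  intro X _ _ _ _
  by_contra hX
  obtain ⟨g, hg⟩ := exists_isLoxodromic_of_not_isElementary hX
  exact h X g hg

theorem NNE.ngt {G : Type u} [Group G] (h : NNE.{u, w} G) : NGT.{u, w} G :=
  fun X _ _ _ _ hX => hX.1 (h X)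

theorem NL.trivial : HoldsForTrivial NL.{u, w} := by
  intro G _ _ X _ _ _ _ g hg
  rw [Subsingleton.elim g 1] at hg
  exact not_isLoxodromic_one hg

theorem NNE.trivial : HoldsForTrivial NNE.{u, w} :=
  fun G _ h => (NL.trivial G h).nne

theorem NGT.trivial : HoldsForTrivial NGT.{u, w} :=
  fun G _ h => (NNE.trivial G h).ngt

end Properties

/-! ### Formal consequences: direct sums, hereditary versions, commensurability. -/

section Generic

variable {P : GroupProperty.{u}}

/-- The elements of a direct sum that are supported on a finite set. -/
def directSumSupportedOn {ι : Type u} (A : ι → Type u) [∀ i, Group (A i)] (s : Finset ι) :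
    Subgroup (directSum A) where
  carrier := {f | ∀ i ∉ s, f.1 i = 1}
  one_mem' := by simp
  mul_mem' {f g} hf hg i hi := by simp [hf i hi, hg i hi]
  inv_mem' {f} hf i hi := by simp [hf i hi]

open Classical in
/-- Changing one coordinate of a finitely supported element. -/
noncomputable def directSumInsert {ι : Type u} (A : ι → Type u) [∀ i, Group (A i)] (s : Finset ι)
    (i : ι) : directSumSupportedOn A s × A i →* directSumSupportedOn A (insert i s) :=
  MonoidHom.mk' (fun p => ⟨⟨Function.update p.1.1.1 i p.2, by
      refine (p.1.1.2.insert i).subset fun j hj => ?_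
      by_cases h : j = i
      · exact Or.inl h
      · exact Or.inr (by simpa [h] using hj)⟩, fun j hj => by
      rw [Finset.mem_insert, not_or] at hj
      simpa [hj.1] using p.1.2 j hj.2⟩) fun p q => by
    ext j
    by_cases h : j = i
    · subst h; simp
    · simp [h]

theorem directSumInsert_surjective {ι : Type u} (A : ι → Type u) [∀ i, Group (A i)]
    (s : Finset ι) (i : ι) : Function.Surjective (directSumInsert A s i) := by
  classical
  intro f
  refine ⟨(⟨⟨Function.update f.1.1 i 1, ?_⟩, fun j hj => ?_⟩, f.1.1 i), ?_⟩
  · refine f.1.2.subset fun j hj => ?_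
    by_cases h : j = i
    · subst h; simp at hj
    · simpa [h] using hj
  · by_cases h : j = i
    · subst h; simp
    · simpa [h] using f.2 j (by simp [h, hj])
  · ext j
    simp [directSumInsert]

theorem PreservedByDirectedUnions.directSums (hU : PreservedByDirectedUnions P)
    (hQ : PreservedByQuotients P) (hB : PreservedByProducts P) (hT : HoldsForTrivial P) :
    PreservedByDirectSums P := by
  classical
  intro ι A _ hA
  have hfin : ∀ s : Finset ι, P (directSumSupportedOn A s) := by
    intro s
    induction s using Finset.induction_on with
    | empty =>
      refine hT _ ⟨fun f g => ?_⟩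
      ext j
      rw [f.2 j (by simp), g.2 j (by simp)]
    | insert i s hi ih =>
      convert hQ _ _ (directSumInsert A s i) (directSumInsert_surjective A s i) (hB _ _ ih (hA i))
  refine hU _ (range (directSumSupportedOn A)) (range_nonempty _) ?_ (fun f => ?_) ?_
  · rintro _ ⟨s, rfl⟩ _ ⟨t, rfl⟩
    refine ⟨_, ⟨s ∪ t, rfl⟩, fun f hf i hi => hf i ?_, fun f hf i hi => hf i ?_⟩ <;>
    simp_all
  · exact ⟨_, ⟨f.2.toFinset, rfl⟩, fun i hi => by
      by_contra h
      exact hi (f.2.mem_toFinset.2 h)⟩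
  · rintro _ ⟨s, rfl⟩
    exact hfin s

/-- Both groups are `H ⊓ K`; the isomorphism between them is used as a quotient map. -/
theorem PreservedByQuotients.subgroupOf_swap (hQ : PreservedByQuotients P) {G : Type u} [Group G]
    {H K : Subgroup G} (h : P (H.subgroupOf K)) : P (K.subgroupOf H) :=
  hQ _ _ (MonoidHom.mk' (fun x : H.subgroupOf K => (⟨⟨x.1.1, x.2⟩, x.1.2⟩ : K.subgroupOf H))
    fun _ _ => rfl) (fun y => ⟨⟨⟨y.1.1, y.2⟩, y.1.2⟩, rfl⟩) h

theorem finiteIndex_comap {G Q : Type u} [Group G] [Group Q] (f : G →* Q) (H : Subgroup Q)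
    [H.FiniteIndex] : (H.comap f).FiniteIndex :=
  ⟨by
    rw [Subgroup.index_comap]
    exact Subgroup.FiniteIndex.index_ne_zero (H := H.subgroupOf f.range)⟩

theorem PreservedByQuotients.hereditary (hQ : PreservedByQuotients P) :
    PreservedByQuotients (Hereditary P) := by
  intro G Q _ _ f hf h H hH
  have : (H.comap f).FiniteIndex := finiteIndex_comap f H
  exact hQ _ _ (f.subgroupComap H) (f.subgroupComap_surjective_of_surjective H hf) (h _ this)

/-- A finite-index `K` is the directed union of its intersections with the members of `F`, each of
finite index in that member. -/
theorem PreservedByDirectedUnions.hereditary (hU : PreservedByDirectedUnions P)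
    (hQ : PreservedByQuotients P) : PreservedByDirectedUnions (Hereditary P) := by
  intro G _ F hne hdir hcov h K hK
  refine hU K ((fun H => H.subgroupOf K) '' F) (hne.image _) ?_ (fun g => ?_) ?_
  · rintro _ ⟨H, hH, rfl⟩ _ ⟨H', hH', rfl⟩
    obtain ⟨L, hL, h1, h2⟩ := hdir H hH H' hH'
    exact ⟨_, ⟨L, hL, rfl⟩, fun x hx => h1 hx, fun x hx => h2 hx⟩
  · obtain ⟨H, hH, hg⟩ := hcov g
    exact ⟨_, ⟨H, hH, rfl⟩, hg⟩
  · rintro _ ⟨H, hH, rfl⟩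
    exact hQ.subgroupOf_swap (h H hH (K.subgroupOf H) inferInstance)

theorem PreservedByFiniteExtensions.hereditary (hE : PreservedByFiniteExtensions P)
    (hQ : PreservedByQuotients P) : PreservedByFiniteExtensions (Hereditary P) := by
  intro G _ K hK h H hH
  exact hE H (K.subgroupOf H) inferInstance
    (hQ.subgroupOf_swap (h (H.subgroupOf K) inferInstance))

/-- A finite-index subgroup of a product need not be a product, but contains one of finite index;
hence the need for finite extensions. -/
theorem PreservedByProducts.hereditary (hB : PreservedByProducts P) (hQ : PreservedByQuotients P)
    (hE : PreservedByFiniteExtensions P) : PreservedByProducts (Hereditary P) := by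
  intro A B _ _ hA hB' K hK
  set K₁ := K.comap (MonoidHom.inl A B)
  set K₂ := K.comap (MonoidHom.inr A B)
  have h₁ : K₁.FiniteIndex := finiteIndex_comap _ K
  have h₂ : K₂.FiniteIndex := finiteIndex_comap _ K
  have hle : K₁.prod K₂ ≤ K := fun x hx => by
    have := K.mul_mem hx.1 hx.2
    simpa using this
  have hfin : (K₁.prod K₂).FiniteIndex :=
    ⟨by rw [Subgroup.index_prod]; exact mul_ne_zero h₁.index_ne_zero h₂.index_ne_zero⟩
  refine hE K ((K₁.prod K₂).subgroupOf K) inferInstance ?_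
  refine hQ (K₁ × K₂) _ (MonoidHom.mk' (fun x =>
    (⟨⟨(x.1.1, x.2.1), hle ⟨x.1.2, x.2.2⟩⟩, ⟨x.1.2, x.2.2⟩⟩ : (K₁.prod K₂).subgroupOf K))
    fun _ _ => rfl) (fun y => ⟨(⟨_, y.2.1⟩, ⟨_, y.2.2⟩), rfl⟩)
    (hB _ _ (hA K₁ h₁) (hB' K₂ h₂))

theorem HoldsForTrivial.hereditary (hT : HoldsForTrivial P) : HoldsForTrivial (Hereditary P) :=
  fun _ _ _ H _ => hT H inferInstance

theorem Hereditary.subgroup (hQ : PreservedByQuotients P) {G : Type u} [Group G]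
    (h : Hereditary P G) (G₀ : Subgroup G) (hG₀ : G₀.FiniteIndex) : Hereditary P G₀ := by
  intro K hK
  have hfin : (K.map G₀.subtype).FiniteIndex := ⟨by
    rw [Subgroup.index_map_subtype]
    exact mul_ne_zero hK.index_ne_zero hG₀.index_ne_zero⟩
  exact hQ _ _ (K.equivMapOfInjective G₀.subtype G₀.subtype_injective).symm.toMonoidHom
    (MulEquiv.surjective _) (h _ hfin)

/-- Heredity goes down to `G₀`, the isomorphism across to `H₀`, and finite extension up to `H`. -/
theorem PreservedByFiniteExtensions.commensurabilityInvariant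
    (hE : PreservedByFiniteExtensions P) (hQ : PreservedByQuotients P) :
    CommensurabilityInvariant (Hereditary P) := by
  rintro G H _ _ ⟨G₀, H₀, hG₀, hH₀, ⟨e⟩⟩ h
  exact hE.hereditary hQ H H₀ hH₀
    (hQ.hereditary _ _ e.toMonoidHom e.surjective (h.subgroup hQ G₀ hG₀))

theorem stable_of_preserved (hQ : PreservedByQuotients P) (hU : PreservedByDirectedUnions P)
    (hB : PreservedByProducts P) (hT : HoldsForTrivial P) : Stable P :=
  ⟨hQ, hU, hU.directSums hQ hB hT⟩

theorem stable_hereditary_of_preserved (hQ : PreservedByQuotients P)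
    (hU : PreservedByDirectedUnions P) (hB : PreservedByProducts P) (hT : HoldsForTrivial P)
    (hE : PreservedByFiniteExtensions P) : Stable (Hereditary P) :=
  stable_of_preserved hQ.hereditary (hU.hereditary hQ) (hB.hereditary hQ hE) hT.hereditary

end Generic

/-! ### The real line as a hyperbolic space. -/

section Line

theorem gromovProduct_min_le_real (o x y z : ℝ) :
    min (gromovProduct o x y) (gromovProduct o y z) ≤ gromovProduct o x z := by
  simp only [gromovProduct, Real.dist_eq]
  rw [min_le_iff]
  rcases abs_cases (o - x) with h1 | h1 <;> rcases abs_cases (o - y) with h2 | h2 <;>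
  rcases abs_cases (o - z) with h3 | h3 <;> rcases abs_cases (x - y) with h4 | h4 <;>
  rcases abs_cases (y - z) with h5 | h5 <;> rcases abs_cases (x - z) with h6 | h6 <;>
  first
  | (left; linarith)
  | (right; linarith)

instance hyperbolicSpace_uLift_real : HyperbolicSpace (ULift.{w} ℝ) where
  nonempty := inferInstance
  geodesic x y := by
    rcases le_total x.down y.down with h | h
    · refine ⟨fun t => ⟨x.down + t⟩, by simp, ?_, fun s _ t _ => ?_⟩
      · rw [ULift.dist_eq, Real.dist_eq, abs_sub_comm, abs_of_nonneg (sub_nonneg.2 h)]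
        ext
        simp
      · rw [ULift.dist_eq, Real.dist_eq]
        simp
    · refine ⟨fun t => ⟨x.down - t⟩, by simp, ?_, fun s _ t _ => ?_⟩
      · rw [ULift.dist_eq, Real.dist_eq, abs_of_nonneg (sub_nonneg.2 h)]
        ext
        simp
      · rw [ULift.dist_eq, Real.dist_eq, abs_sub_comm]
        simp
  four_point := ⟨0, fun o x y z => by
    rw [sub_zero]
    exact gromovProduct_min_le_real o.down x.down y.down z.down⟩

/-- A group with an infinite cyclic quotient acts on the line with a loxodromic element. -/
theorem not_nl_of_hom {G : Type u} [Group G] (f : G →* Multiplicative ℤ) {g : G}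
    (hg : f g = Multiplicative.ofAdd 1) : ¬ NL.{u, w} G := by
  intro h
  let _ : MulAction G (ULift.{w} ℝ) :=
    { smul := fun a x => ⟨((f a).toAdd : ℝ) + x.down⟩
      one_smul := fun x => by
        change (⟨((f 1).toAdd : ℝ) + x.down⟩ : ULift ℝ) = x
        simp
      mul_smul := fun a b x => by
        change (⟨((f (a * b)).toAdd : ℝ) + x.down⟩ : ULift ℝ) =
          ⟨((f a).toAdd : ℝ) + (((f b).toAdd : ℝ) + x.down)⟩
        simp [add_assoc] }
  have smul_def : ∀ (a : G) (x : ULift.{w} ℝ), (a • x).down = ((f a).toAdd : ℝ) + x.down :=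
    fun _ _ => rfl
  have : IsIsometricSMul G (ULift.{w} ℝ) := ⟨fun a => Isometry.of_dist_eq fun x y => by
    rw [ULift.dist_eq, ULift.dist_eq, smul_def, smul_def, dist_add_left]⟩
  refine h (ULift.{w} ℝ) g (isLoxodromic_of_le_dist (x := ⟨0⟩) one_pos fun n => ?_)
  rw [ULift.dist_eq, smul_def, map_pow, hg, ← ofAdd_nsmul, Real.dist_eq]
  simp

end Line

/-! ### The lattice with its rotation of order four: (NL) is not commensurability invariant. -/

section Rotation

/-- If `g` commutes with its conjugate by `r`, and `r ^ 2` inverts `g`, then `g` is not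
loxodromic. -/
theorem not_isLoxodromic_of_inverted {X : Type w} [MetricSpace X] [HyperbolicSpace X]
    {G : Type u} [Group G] [MulAction G X] [IsIsometricSMul G X] {g r : G}
    (hcomm : Commute g (r * g * r⁻¹)) (hinv : r ^ 2 * g * (r ^ 2)⁻¹ = g⁻¹) :
    ¬ IsLoxodromic X g := by
  intro hg
  obtain ⟨ξ, η, hp⟩ := hg.exists_hasPoles
  have hr := hp.conj r
  -- The conjugate commutes with `g`, so it fixes `ξ` and `η`, which must therefore be its own poles
  -- `r • ξ` and `r • η` in some order.
  have h1 := hr.eq_or_eq_of_smul_eq (hp.smul_left_eq_of_commute hcomm.symm)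
  have h2 := hr.eq_or_eq_of_smul_eq (hp.smul_right_eq_of_commute hcomm.symm)
  have hfix : r ^ 2 • ξ = ξ := by
    rw [pow_two, mul_smul]
    rcases h1 with h1 | h1
    · rw [← h1, ← h1]
    · rcases h2 with h2 | h2
      · rw [← h2, ← h1]
      · exact absurd (h1.trans h2.symm) hp.1
  have hswap : r ^ 2 • ξ = η := by
    obtain ⟨hne, N, x, c1, c2⟩ := hp
    have c3 := c1.smul (r ^ 2)
    refine c3.unique (c2.of_dist_le (C := dist x (r ^ 2 • x)) fun n => le_of_eq ?_)
    rw [← hinv, conj_pow, conj_pow, ← mul_smul (r ^ 2) _ x]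
    rw [← dist_smul ((r ^ 2 * (g ^ N) ^ n * (r ^ 2)⁻¹)) x (r ^ 2 • x), ← mul_smul _ (r ^ 2) x,
      inv_mul_cancel_right]
  exact hp.1 (hfix.symm.trans hswap)

/-- The free abelian group of rank two. -/
abbrev Lattice : Type u := Multiplicative (ULift.{u} ℤ × ULift.{u} ℤ)

/-- The rotation of order four of the lattice. -/
def latticeRotation : MulAut Lattice.{u} :=
  AddEquiv.toMultiplicative
    { toFun := fun p => (-p.2, p.1)
      invFun := fun p => (p.2, -p.1)
      left_inv := fun p => by simp
      right_inv := fun p => by simp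
      map_add' := fun p q => by ext <;> simp [add_comm] }

theorem latticeRotation_sq_apply (a : Lattice.{u}) : (latticeRotation ^ 2) a = a⁻¹ := rfl

theorem latticeRotation_pow_four : latticeRotation.{u} ^ 4 = 1 := by
  ext a : 1
  rw [show (4 : ℕ) = 2 + 2 from rfl, pow_add, MulAut.mul_apply, latticeRotation_sq_apply,
    latticeRotation_sq_apply, inv_inv, MulAut.one_apply]

/-- The orientation-preserving isometry group of the square lattice. -/
abbrev LatticeIsometries : Type u :=
  Lattice.{u} ⋊[(Subgroup.zpowers latticeRotation.{u}).subtype] Subgroup.zpowers latticeRotation.{u}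

instance finite_zpowers_latticeRotation : Finite (Subgroup.zpowers latticeRotation.{u}) :=
  (isOfFinOrder_iff_pow_eq_one.2 ⟨4, by norm_num, latticeRotation_pow_four⟩).finite_zpowers

theorem nl_latticeIsometries : NL.{u, w} LatticeIsometries.{u} := by
  intro X _ _ _ _ g hg
  -- The fourth power of every element is a translation, and it is loxodromic if the element is.
  have h4 : (g ^ 4).right = 1 := by
    obtain ⟨k, hk⟩ := Subgroup.mem_zpowers_iff.1 g.right.2
    have : (g ^ 4).right = g.right ^ 4 := map_pow SemidirectProduct.rightHom g 4
    rw [this]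
    ext1
    push_cast
    rw [← hk, ← zpow_natCast, ← zpow_mul, mul_comm, zpow_mul, zpow_natCast,
      latticeRotation_pow_four, one_zpow]
  obtain ⟨a, ha⟩ : ∃ a : Lattice.{u}, g ^ 4 = SemidirectProduct.inl a :=
    ⟨(g ^ 4).left, by ext1 <;> simp [h4]⟩
  have hlox := hg.pow four_ne_zero
  rw [ha] at hlox
  have hr := SemidirectProduct.inl_aut (φ := (Subgroup.zpowers latticeRotation.{u}).subtype)
  refine not_isLoxodromic_of_inverted
    (r := SemidirectProduct.inr ⟨latticeRotation, Subgroup.mem_zpowers _⟩) ?_ ?_ hlox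
  · rw [← map_inv SemidirectProduct.inr, ← hr]
    exact (Commute.all a _).map SemidirectProduct.inl
  · rw [← map_pow, ← map_inv SemidirectProduct.inr, ← hr, ← map_inv]
    exact congrArg _ (latticeRotation_sq_apply a)

theorem not_commensurabilityInvariant_nl : ¬ CommensurabilityInvariant NL.{u, w} := by
  intro h
  have hcomm : CommensurableGroups LatticeIsometries.{u} Lattice.{u} := by
    refine ⟨(SemidirectProduct.rightHom
      (φ := (Subgroup.zpowers latticeRotation.{u}).subtype)).ker, ⊤, inferInstance,
      inferInstance, ⟨?_⟩⟩
    refine MulEquiv.trans ?_ Subgroup.topEquiv.symm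
    rw [← SemidirectProduct.range_inl_eq_ker_rightHom]
    exact (MonoidHom.ofInjective SemidirectProduct.inl_injective).symm
  refine not_nl_of_hom.{u, w} (G := Lattice.{u}) (AddMonoidHom.toMultiplicative
    ((AddEquiv.ulift : ULift.{u} ℤ ≃+ ℤ).toAddMonoidHom.comp (AddMonoidHom.fst _ _)))
    (g := Multiplicative.ofAdd (⟨1⟩, 0)) rfl (h _ _ hcomm nl_latticeIsometries)

end Rotation

end HypAct

theorem mainTheorem9 :
    (HypAct.Stable HypAct.NGT.{u, w} ∧ HypAct.Stable HypAct.NNE.{u, w} ∧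
      HypAct.Stable HypAct.NL.{u, w}) ∧
    (HypAct.Stable (HypAct.Hereditary HypAct.NGT.{u, w}) ∧
      HypAct.Stable (HypAct.Hereditary HypAct.NNE.{u, w}) ∧
      HypAct.Stable (HypAct.Hereditary HypAct.NL.{u, w})) ∧
    (HypAct.CommensurabilityInvariant (HypAct.Hereditary HypAct.NL.{u, w}) ∧
      HypAct.CommensurabilityInvariant (HypAct.Hereditary HypAct.NNE.{u, w}) ∧
      HypAct.CommensurabilityInvariant (HypAct.Hereditary HypAct.NGT.{u, w})) ∧
    ¬ HypAct.CommensurabilityInvariant HypAct.NL.{u, w} :=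
  ⟨⟨HypAct.stable_of_preserved HypAct.NGT.quotients HypAct.NGT.directedUnions
      HypAct.NGT.products HypAct.NGT.trivial,
    HypAct.stable_of_preserved HypAct.NNE.quotients HypAct.NNE.directedUnions
      HypAct.NNE.products HypAct.NNE.trivial,
    HypAct.stable_of_preserved HypAct.NL.quotients HypAct.NL.directedUnions
      HypAct.NL.products HypAct.NL.trivial⟩,
  ⟨HypAct.stable_hereditary_of_preserved HypAct.NGT.quotients HypAct.NGT.directedUnions
      HypAct.NGT.products HypAct.NGT.trivial HypAct.NGT.finiteExtensions,
    HypAct.stable_hereditary_of_preserved HypAct.NNE.quotients HypAct.NNE.directedUnions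
      HypAct.NNE.products HypAct.NNE.trivial HypAct.NNE.finiteExtensions,
    HypAct.stable_hereditary_of_preserved HypAct.NL.quotients HypAct.NL.directedUnions
      HypAct.NL.products HypAct.NL.trivial HypAct.NL.finiteExtensions⟩,
  ⟨HypAct.NL.finiteExtensions.commensurabilityInvariant HypAct.NL.quotients,
    HypAct.NNE.finiteExtensions.commensurabilityInvariant HypAct.NNE.quotients,
    HypAct.NGT.finiteExtensions.commensurabilityInvariant HypAct.NGT.quotients⟩,
  HypAct.not_commensurabilityInvariant_nl⟩
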